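/- Let $V:\mathbb R\to[0,\infty)$ be smooth and symmetric with $0<\delta_-\le V''\le\delta_+<\infty$ and $\delta_- /\delta_+>(3/4)^{1/16}$, and let $\beta>0$, $\gamma>0$. On $\Omega=(\mathbb R^2)^{\mathbb Z}$, with configurations $\omega=(p_i,r_i)_{i\in\mathbb Z}$, let $\nu_\beta$ be the product measure with one-site density $e^{-\beta(p^2/2+V(r))}/(\sqrt{2\pi\beta^{-1}}\,Z_\beta)$, $Z_\beta=\int e^{-\beta V(r)}\,dr$, and write $\langle f\rangle_\beta=\int f\,d\nu_\beta$. Put $Y_{i,j}=p_i\partial_{r_j}-V'(r_j)\partial_{p_i}$, $X_i=Y_{i,i}$, $$A=\sum_{i\in\mathbb Z}(X_i-Y_{i,i+1}),\qquad S=\frac\gamma2\sum_{i\in\mathbb Z}\big(X_i^2+Y_{i,i+1}^2\big),\qquad L=S+A,$$ $\mathcal E_i=p_i^2/2+V(r_i)$, and let $W_{0,1}=-p_0V'(r_1)+\frac\gamma2\{p_0^2V''(r_1)-V'(r_1)^2\}$ be the energy current. Let $\tau_j$ be the shift, $\tau_jF(\omega)=F((\omega_{i+j})_i)$. Let $\mathcal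 C$ be the linear space generated by the smooth compactly supported functions $F$ of finitely many coordinates with $\langle F\rangle_\beta=0$, and $\Gamma_F=\sum_j\tau_jF$ (a formal sum; $X_0\Gamma_F=\sum_jX_0\tau_jF$ and $Y_{0,1}\Gamma_F=\sum_jY_{0,1}\tau_jF$ are finite sums). Let $\mathcal C_0$ be the set of finite sums $\sum_i(X_iF_i+Y_{i,i+1}G_i)$, where $F_i,G_i$ are smooth functions of finitely many coordinates which, together with all their images under $X_k$ and $Y_{k,k+1}$, $k\in\mathbb Z$, lie in $L^2(\nu_\beta)$. For $h\in\mathcal C_0$ set $$|\!|\!|h|\!|\!|_{-1}^2=\sup_{g\in\mathcal C,\,a\in\mathbb R}\Big\{2\sum_{i}\langle g\,\tau_ih\rangle_\beta+2a\sum_{i}i\,\langle h\,\mathcal E_i\rangle_\beta-\frac\gamma2\big\langle(a\,p_0V'(r_1)+Y_{0,1}\Gamma_g)^2\big\rangle_\beta-\frac\gamma2\big\langle(X_0\Gamma_g)^2\big\rangle_\beta\Big\},$$ and let $\mathcal H_{-1}$ be the completion of $\mathcal C_0$ (modulo the kernel) for this seminorm. The diffusion constant $\kappa_\beta$ is defined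 as the unique real number such that $$W_{0,1}+\kappa_\beta\,(p_1^2-p_0^2)\in\overline{L\mathcal C}\quad\text{in }\mathcal H_{-1},$$ that is, such that $|\!|\!|W_{0,1}+\kappa_\beta(p_1^2-p_0^2)-LF_K|\!|\!|_{-1}\to0$ for some sequence $(F_K)$ in $\mathcal C$. **Proposition.** The constant $\kappa_\beta$ is well defined (there is exactly one such real number), and $$\kappa_\beta\ \ge\ \frac{\gamma}{4\,\beta\,\langle r_0^2\rangle_\beta}.$$ -/

import Mathlib

open MeasureTheory Filter Topology

noncomputable section

/-- Data and standing assumptions of the model: a smooth, symmetric, nonnegative interaction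
potential `V` with `0 < δ₋ ≤ V'' ≤ δ₊` and `δ₋ / δ₊ > (3/4)^(1/16)`, an inverse temperature `β > 0`
and a noise strength `γ > 0`. -/
structure EnergyChain where
  V : ℝ → ℝ
  δm : ℝ
  δp : ℝ
  β : ℝ
  γ : ℝ
  V_nonneg : ∀ r, 0 ≤ V r
  V_smooth : ContDiff ℝ (⊤ : ℕ∞) V
  V_symm : ∀ r, V (-r) = V r
  δm_pos : 0 < δm
  le_V'' : ∀ r, δm ≤ deriv (deriv V) r
  V''_le : ∀ r, deriv (deriv V) r ≤ δp
  δ_ratio : ((3 : ℝ) / 4) ^ ((1 : ℝ) / 16) < δm / δp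
  β_pos : 0 < β
  γ_pos : 0 < γ

namespace EnergyChain

/-- Configurations `ω = (p_i, r_i)_{i ∈ ℤ}`: `(ω i).1 = p_i` and `(ω i).2 = r_i`. -/
abbrev Config : Type := ℤ → ℝ × ℝ

/-! ### The Gibbs measure -/

/-- `Z_β = ∫ exp (-β V(r)) dr`. -/
def Z (M : EnergyChain) : ℝ := ∫ r, Real.exp (-M.β * M.V r)

/-- The one-site Gibbs measure, of density
`exp (-β (p²/2 + V(r))) / (√(2π β⁻¹) Z_β)` with respect to `dp dr`. -/
def siteMeasure (M : EnergyChain) : Measure (ℝ × ℝ) :=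
  volume.withDensity fun x => ENNReal.ofReal
    (Real.exp (-M.β * (x.1 ^ 2 / 2 + M.V x.2)) / (√(2 * Real.pi * M.β⁻¹) * M.Z))

lemma le_V (M : EnergyChain) (r : ℝ) : M.δm / 2 * r ^ 2 ≤ M.V r := by
  have hd : Differentiable ℝ M.V := M.V_smooth.differentiable (by simp)
  have hd' : Differentiable ℝ (deriv M.V) :=
    ((contDiff_infty_iff_deriv.1 M.V_smooth).2).differentiable (by simp)
  have h1 : deriv (fun x => M.V x - M.δm / 2 * x ^ 2) = fun x => deriv M.V x - M.δm * x := by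
    funext x
    have := ((hd x).hasDerivAt).sub (((hasDerivAt_pow 2 x)).const_mul (M.δm / 2))
    refine (this.deriv).trans ?_
    simp only [Nat.cast_ofNat]
    ring
  have hc : ConvexOn ℝ Set.univ (fun x => M.V x - M.δm / 2 * x ^ 2) := by
    refine convexOn_univ_of_deriv2_nonneg (by fun_prop) ?_ ?_
    · rw [h1]; fun_prop
    · intro x
      have h2 : deriv^[2] (fun x => M.V x - M.δm / 2 * x ^ 2) x = deriv (deriv M.V) x - M.δm := by
        simp only [Function.iterate_succ, Function.iterate_zero, Function.comp_apply, id]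
        rw [h1]
        have := ((hd' x).hasDerivAt).sub ((hasDerivAt_id x).const_mul M.δm)
        refine (this.deriv).trans ?_
        simp
      rw [h2]
      linarith [M.le_V'' x]
  have := hc.2 (Set.mem_univ r) (Set.mem_univ (-r)) (show (0 : ℝ) ≤ 1 / 2 by norm_num)
    (show (0 : ℝ) ≤ 1 / 2 by norm_num) (by norm_num)
  have h0 := M.V_nonneg 0
  have hs := M.V_symm r
  simp only [smul_eq_mul] at this
  rw [show (1 : ℝ) / 2 * r + 1 / 2 * -r = 0 by ring, hs] at this
  nlinarith

lemma integrable_exp_V (M : EnergyChain) : Integrable fun r => Real.exp (-M.β * M.V r) := by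
  have hb : 0 < M.β * (M.δm / 2) := mul_pos M.β_pos (half_pos M.δm_pos)
  refine (integrable_exp_neg_mul_sq hb).mono' ?_ ?_
  · have := M.V_smooth.continuous
    exact (by fun_prop : Continuous fun r => Real.exp (-M.β * M.V r)).aestronglyMeasurable
  · refine Eventually.of_forall fun r => ?_
    rw [Real.norm_eq_abs, Real.abs_exp]
    refine Real.exp_le_exp.2 ?_
    have := mul_le_mul_of_nonneg_left (M.le_V r) M.β_pos.le
    nlinarith

lemma Z_pos (M : EnergyChain) : 0 < M.Z := integral_exp_pos M.integrable_exp_V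

instance (M : EnergyChain) : IsProbabilityMeasure M.siteMeasure := by
  constructor
  have hc := M.V_smooth.continuous
  have hp : Integrable fun p : ℝ => Real.exp (-(M.β / 2) * p ^ 2) :=
    integrable_exp_neg_mul_sq (half_pos M.β_pos)
  have hsplit : (fun x : ℝ × ℝ =>
      Real.exp (-M.β * (x.1 ^ 2 / 2 + M.V x.2)) / (√(2 * Real.pi * M.β⁻¹) * M.Z)) =
      fun x => (Real.exp (-(M.β / 2) * x.1 ^ 2) * Real.exp (-M.β * M.V x.2)) /
        (√(2 * Real.pi * M.β⁻¹) * M.Z) := by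
    funext x
    rw [← Real.exp_add]
    ring_nf
  have hint : Integrable (fun x : ℝ × ℝ =>
      Real.exp (-M.β * (x.1 ^ 2 / 2 + M.V x.2)) / (√(2 * Real.pi * M.β⁻¹) * M.Z)) := by
    rw [hsplit]
    exact (hp.mul_prod M.integrable_exp_V).div_const _
  have hsq : 0 < √(2 * Real.pi * M.β⁻¹) :=
    Real.sqrt_pos.2 (mul_pos Real.two_pi_pos (inv_pos.2 M.β_pos))
  have hval : ∫ x : ℝ × ℝ,
      Real.exp (-M.β * (x.1 ^ 2 / 2 + M.V x.2)) / (√(2 * Real.pi * M.β⁻¹) * M.Z) = 1 := by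
    rw [hsplit, integral_div, Measure.volume_eq_prod,
      integral_prod_mul (fun p : ℝ => Real.exp (-(M.β / 2) * p ^ 2))
        (fun r : ℝ => Real.exp (-M.β * M.V r)), integral_gaussian]
    have : Real.pi / (M.β / 2) = 2 * Real.pi * M.β⁻¹ := by
      have := M.β_pos.ne'
      field_simp
    rw [this]
    exact div_self (mul_pos hsq M.Z_pos).ne'
  rw [siteMeasure, withDensity_apply _ MeasurableSet.univ, Measure.restrict_univ,
    ← ofReal_integral_eq_lintegral_ofReal hint, hval, ENNReal.ofReal_one]
  refine Eventually.of_forall fun x => ?_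
  have := M.Z_pos
  positivity

/-- The product measure `ν_β` on `(ℝ²)^ℤ`; `⟨f⟩_β = ∫ f dν_β`. -/
def gibbs (M : EnergyChain) : Measure Config := Measure.infinitePi fun _ : ℤ => M.siteMeasure

/-! ### Shifts, vector fields and generators -/

/-- `(τ_j F)(ω) = F(τ_j ω)` with `(τ_j ω)_i = ω_{i+j}`. -/
def shift (j : ℤ) (F : Config → ℝ) : Config → ℝ := fun ω => F fun i => ω (i + j)

/-- `∂F/∂p_i`. -/
def dp (i : ℤ) (F : Config → ℝ) : Config → ℝ := fun ω =>
  deriv (fun t => F (Function.update ω i (t, (ω i).2))) (ω i).1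

/-- `∂F/∂r_i`. -/
def dr (i : ℤ) (F : Config → ℝ) : Config → ℝ := fun ω =>
  deriv (fun t => F (Function.update ω i ((ω i).1, t))) (ω i).2

/-- `Y_{i,j} = p_i ∂_{r_j} - V'(r_j) ∂_{p_i}`. -/
def Y (M : EnergyChain) (i j : ℤ) (F : Config → ℝ) : Config → ℝ := fun ω =>
  (ω i).1 * dr j F ω - deriv M.V (ω j).2 * dp i F ω

/-- `X_i = Y_{i,i}`. -/
def X (M : EnergyChain) (i : ℤ) (F : Config → ℝ) : Config → ℝ := M.Y i i F

/-- `S^γ F = (γ/2) ∑_i (X_i² F + Y_{i,i+1}² F)`; for local `F` only finitely many terms are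
nonzero. -/
def S (M : EnergyChain) (F : Config → ℝ) : Config → ℝ := fun ω =>
  M.γ / 2 * ∑ᶠ i : ℤ, (M.X i (M.X i F) ω + M.Y i (i + 1) (M.Y i (i + 1) F) ω)

/-- `A F = ∑_i (X_i F - Y_{i,i+1} F)`. -/
def A (M : EnergyChain) (F : Config → ℝ) : Config → ℝ := fun ω =>
  ∑ᶠ i : ℤ, (M.X i F ω - M.Y i (i + 1) F ω)

/-- `L^γ = S^γ + A`. -/
def L (M : EnergyChain) (F : Config → ℝ) : Config → ℝ := M.S F + M.A F

/-- The energy `ℰ_i = p_i²/2 + V(r_i)`. -/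
def energy (M : EnergyChain) (i : ℤ) : Config → ℝ := fun ω => (ω i).1 ^ 2 / 2 + M.V (ω i).2

/-- The microscopic energy current
`W_{0,1} = -p_0 V'(r_1) + (γ/2) (p_0² V''(r_1) - V'(r_1)²)`. -/
def current (M : EnergyChain) : Config → ℝ := fun ω =>
  -((ω 0).1 * deriv M.V (ω 1).2) +
    M.γ / 2 * ((ω 0).1 ^ 2 * deriv (deriv M.V) (ω 1).2 - deriv M.V (ω 1).2 ^ 2)

/-- The gradient `p_1² - p_0²`. -/
def gradient : Config → ℝ := fun ω => (ω 1).1 ^ 2 - (ω 0).1 ^ 2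

/-! ### Spaces of local functions -/

/-- `F` is a smooth function of finitely many coordinates. -/
def IsSmoothLocal (F : Config → ℝ) : Prop :=
  ∃ (Λ : Finset ℤ) (φ : (Λ → ℝ × ℝ) → ℝ), ContDiff ℝ (⊤ : ℕ∞) φ ∧ F = fun ω => φ fun i => ω i

/-- `F` is a smooth, compactly supported function of finitely many coordinates. -/
def IsSmoothLocalCompact (F : Config → ℝ) : Prop :=
  ∃ (Λ : Finset ℤ) (φ : (Λ → ℝ × ℝ) → ℝ),
    ContDiff ℝ (⊤ : ℕ∞) φ ∧ HasCompactSupport φ ∧ F = fun ω => φ fun i => ω i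

/-- The space `𝒞` generated by the smooth local functions with compact support and zero average
with respect to `ν_β`. (A sum of two such functions that depend on different sites need not be
compactly supported in the joint set of coordinates, so the linear span is taken.) -/
def testSpace (M : EnergyChain) : Submodule ℝ (Config → ℝ) :=
  Submodule.span ℝ {F | IsSmoothLocalCompact F ∧ ∫ ω, F ω ∂M.gibbs = 0}

/-- The space of smooth local functions `F` with `F`, `X_i F`, `Y_{i,i+1} F` in `L²(ν_β)` for
all `i`. -/
def smoothL2 (M : EnergyChain) : Set (Config → ℝ) :=
  {F | IsSmoothLocal F ∧ MemLp F 2 M.gibbs ∧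
    ∀ i : ℤ, MemLp (M.X i F) 2 M.gibbs ∧ MemLp (M.Y i (i + 1) F) 2 M.gibbs}

/-- The space `𝒞₀` of finite sums `∑_{i ∈ Λ} (X_i F_i + Y_{i,i+1} G_i)` with `F_i`, `G_i` in
`smoothL2`. -/
def fluctSpace (M : EnergyChain) : Set (Config → ℝ) :=
  {h | ∃ (Λ : Finset ℤ) (F G : ℤ → Config → ℝ),
    (∀ i ∈ Λ, F i ∈ M.smoothL2 ∧ G i ∈ M.smoothL2) ∧
    h = ∑ i ∈ Λ, (M.X i (F i) + M.Y i (i + 1) (G i))}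

/-! ### The seminorm and the diffusion constant -/

/-- `X_0 Γ_F`, where `Γ_F = ∑_j τ_j F` is a formal sum. -/
def XGamma (M : EnergyChain) (F : Config → ℝ) : Config → ℝ := fun ω =>
  ∑ᶠ j : ℤ, M.X 0 (shift j F) ω

/-- `Y_{0,1} Γ_F`. -/
def YGamma (M : EnergyChain) (F : Config → ℝ) : Config → ℝ := fun ω =>
  ∑ᶠ j : ℤ, M.Y 0 1 (shift j F) ω

/-- `≪g, h≫_* = ∑_i ⟨g, τ_i h⟩`; only finitely many terms are nonzero for local, centered
functions. -/
def starForm (M : EnergyChain) (g h : Config → ℝ) : ℝ :=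
  ∑ᶠ i : ℤ, ∫ ω, g ω * shift i h ω ∂M.gibbs

/-- `≪h≫_** = ∑_i i ⟨h, ℰ_i⟩`; only finitely many terms are nonzero for local, centered `h`. -/
def starStarForm (M : EnergyChain) (h : Config → ℝ) : ℝ :=
  ∑ᶠ i : ℤ, (i : ℝ) * ∫ ω, h ω * M.energy i ω ∂M.gibbs

/-- The square of the seminorm `|||h|||_{-1}` for `h ∈ 𝒞₀`: the supremum over `g ∈ 𝒞`, `a ∈ ℝ` of
`2≪g,h≫_* + 2a≪h≫_** - (γ/2)⟨(a p_0 V'(r_1) + Y_{0,1}Γ_g)²⟩ - (γ/2)⟨(X_0 Γ_g)²⟩`. -/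
def normSq (M : EnergyChain) (h : Config → ℝ) : EReal :=
  ⨆ (g : M.testSpace) (a : ℝ),
    ((2 * M.starForm g h + 2 * a * M.starStarForm h
      - M.γ / 2 * ∫ ω, (a * ((ω 0).1 * deriv M.V (ω 1).2) + M.YGamma g ω) ^ 2 ∂M.gibbs
      - M.γ / 2 * ∫ ω, M.XGamma g ω ^ 2 ∂M.gibbs : ℝ) : EReal)

/-- `h ∈ 𝒞₀` lies in the closure of `L𝒞` in the Hilbert space `ℋ₋₁`, the completion of `𝒞₀` for
the seminorm `|||·|||_{-1}`. -/
def MemClosureL (M : EnergyChain) (h : Config → ℝ) : Prop :=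
  h ∈ M.fluctSpace ∧
    ∃ F : ℕ → M.testSpace, Tendsto (fun K => M.normSq (h - M.L (F K))) atTop (𝓝 0)

/-- The defining property of the diffusion constant `κ_β`:
`W_{0,1} + κ_β (p_1² - p_0²)` lies in the closure of `L𝒞` in `ℋ₋₁`. -/
def IsDiffusionConstant (M : EnergyChain) (κ : ℝ) : Prop :=
  M.MemClosureL (M.current + κ • gradient)

end EnergyChain

end

/-!
On the formal sums `Γ = Γ_g + a ∑_k k ℰ_k` only the derivatives `Y_{0,1} Γ` and `X_0 Γ` are
visible; they are those of a local function, a potential of slope `a`. Summation by parts gives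
`L F` and `W_{0,1}` the same form: `W_{0,1}` is the image of the potential of `∑_k k ℰ_k` just as
`L F` is that of the potential of `Γ_F`. So `W_{0,1} + κ (p_1² - p_0²) - L F` corresponds to the
functional `κ β⁻² slope - B(Ψ, ·)`, where `Ψ` is a potential of slope `1` and `B` is the bilinear
form of the generator. The form `B` is coercive for the norm `‖(Y_{0,1} Φ, X_0 Φ)‖` because `X_0`
and `Y_{0,1}` are antisymmetric, and it is bounded by a sector condition. Hence `κ β⁻²` is the
unique constant for which Lax–Milgram puts the solution of `B(z, ·) = κ β⁻² slope` at slope `1`.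
The slope is recovered as `β²` times the inner product of `(Y_{0,1} Φ, X_0 Φ)` with
`(p_0 r_1, -p_0 r_0)`, and the Cauchy–Schwarz inequality for this inner product is the lower bound
on `κ`.
-/

noncomputable section

/-! ### A Lax–Milgram problem along a linear map -/

section LaxMilgram

variable {E H : Type*} [AddCommGroup E] [Module ℝ E] [NormedAddCommGroup H]
  {lam : ℝ}

/-- Up to the factor `lam`, the square of the dual norm of the functional `ℓ` for the seminorm
`y ↦ ‖ξ y‖`, in its variational form. -/
def dualNormSq [NormedSpace ℝ H] (ξ : E →ₗ[ℝ] H) (lam : ℝ) (ℓ : E →ₗ[ℝ] ℝ) : EReal :=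
  ⨆ y, ((2 * ℓ y - lam * ‖ξ y‖ ^ 2 : ℝ) : EReal)

section NormedSpace

variable [NormedSpace ℝ H] {ξ : E →ₗ[ℝ] H} {ℓ : E →ₗ[ℝ] ℝ}

lemma dualNormSq_le_coe_iff {c : ℝ} :
    dualNormSq ξ lam ℓ ≤ c ↔ ∀ y, 2 * ℓ y - lam * ‖ξ y‖ ^ 2 ≤ c := by
  simp only [dualNormSq, iSup_le_iff, EReal.coe_le_coe_iff]

lemma dualNormSq_nonneg : 0 ≤ dualNormSq ξ lam ℓ :=
  le_iSup_of_le 0 (by simp)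

lemma dualNormSq_le_iff (hlam : 0 < lam) {ε : ℝ} (hε : 0 ≤ ε) :
    dualNormSq ξ lam ℓ ≤ (ε ^ 2 / lam : ℝ) ↔ ∀ y, |ℓ y| ≤ ε * ‖ξ y‖ := by
  rw [dualNormSq_le_coe_iff]
  refine ⟨fun h y => ?_, fun h y => ?_⟩
  · have hquad (t : ℝ) : 0 ≤ lam * ‖ξ y‖ ^ 2 * (t * t) + -(2 * ℓ y) * t + ε ^ 2 / lam := by
      have := h (t • y)
      rw [map_smul, map_smul, norm_smul, mul_pow, Real.norm_eq_abs, sq_abs, smul_eq_mul] at this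
      linarith
    have hdiscrim := discrim_le_zero hquad
    have hcancel : lam * ‖ξ y‖ ^ 2 * (ε ^ 2 / lam) = (ε * ‖ξ y‖) ^ 2 := by field_simp
    rw [discrim, mul_assoc, hcancel] at hdiscrim
    exact abs_le_of_sq_le_sq (by linarith) (by positivity)
  · rw [le_div_iff₀ hlam]
    nlinarith [sq_nonneg (lam * ‖ξ y‖ - ε), le_of_abs_le (h y)]

/-- `μ δ` is a limit, for the dual norm along `ξ`, of functionals `B x` normalized by `δ x = 1`. -/
def IsEffectiveCoeff (ξ : E →ₗ[ℝ] H) (lam : ℝ) (B : E →ₗ[ℝ] E →ₗ[ℝ] ℝ) (δ : E →ₗ[ℝ] ℝ)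
    (μ : ℝ) : Prop :=
  ∃ x : ℕ → E, (∀ n, δ (x n) = 1) ∧
    Tendsto (fun n => dualNormSq ξ lam (μ • δ - B (x n))) atTop (𝓝 0)

end NormedSpace

section Form

variable [InnerProductSpace ℝ H] {ξ : E →ₗ[ℝ] H} {B : E →ₗ[ℝ] E →ₗ[ℝ] ℝ} {δ : E →ₗ[ℝ] ℝ} {C : ℝ}

lemma exists_bilin_extension (hξ : DenseRange ξ) (hB : ∀ x y, |B x y| ≤ C * ‖ξ x‖ * ‖ξ y‖) :
    ∃ B' : H →L[ℝ] H →L[ℝ] ℝ, ∀ x y, B' (ξ x) (ξ y) = B x y := by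
  have hext (x y : E) : (B x).extendOfNorm ξ (ξ y) = B x y :=
    LinearMap.extendOfNorm_eq hξ ⟨C * ‖ξ x‖, hB x⟩ y
  have hunique {f g : H →L[ℝ] ℝ} (h : ∀ y, f (ξ y) = g (ξ y)) : f = g :=
    DFunLike.coe_injective (hξ.equalizer f.continuous g.continuous (funext h))
  let T : E →ₗ[ℝ] H →L[ℝ] ℝ :=
    { toFun := fun x => (B x).extendOfNorm ξ
      map_add' := fun x x' => hunique fun y => by
        rw [add_apply, hext, hext, hext, map_add, LinearMap.add_apply]
      map_smul' := fun t x => hunique fun y => by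
        rw [RingHom.id_apply, smul_apply, hext, hext, map_smul,
          LinearMap.smul_apply] }
  have hT : ∀ x, ‖T x‖ ≤ |C| * ‖ξ x‖ := fun x =>
    LinearMap.opNorm_extendOfNorm_le hξ (by positivity) fun y =>
      (hB x y).trans (by gcongr; exact le_abs_self C)
  refine ⟨T.extendOfNorm ξ, fun x y => ?_⟩
  rw [LinearMap.extendOfNorm_eq hξ ⟨_, hT⟩ x]
  exact hext x y

lemma exists_laxMilgram [CompleteSpace H] (hlam : 0 < lam) (hξ : DenseRange ξ)
    {B' : H →L[ℝ] H →L[ℝ] ℝ} (hB' : ∀ z, lam * ‖z‖ ^ 2 ≤ B' z z)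
    (hδ : ∀ y, |δ y| ≤ C * ‖ξ y‖) : ∃ z, ∀ y, B' z (ξ y) = δ y := by
  have hcoercive : IsCoercive B' := ⟨lam, hlam, fun z => by
    rw [mul_assoc, ← sq]
    exact hB' z⟩
  set v := (InnerProductSpace.toDual ℝ H).symm (δ.extendOfNorm ξ)
  refine ⟨hcoercive.continuousLinearEquivOfBilin.symm v, fun y => ?_⟩
  rw [← hcoercive.continuousLinearEquivOfBilin_apply, ContinuousLinearEquiv.apply_symm_apply,
    InnerProductSpace.toDual_symm_apply, LinearMap.extendOfNorm_eq hξ ⟨C, hδ⟩]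

lemma tendsto_of_isEffectiveCoeff (hlam : 0 < lam) (hξ : DenseRange ξ) {B' : H →L[ℝ] H →L[ℝ] ℝ}
    (hB' : ∀ z, lam * ‖z‖ ^ 2 ≤ B' z z) (hext : ∀ x y, B' (ξ x) (ξ y) = B x y)
    {z : H} (hz : ∀ y, B' z (ξ y) = δ y) {μ : ℝ} {x : ℕ → E}
    (hx : Tendsto (fun n => dualNormSq ξ lam (μ • δ - B (x n))) atTop (𝓝 0)) :
    Tendsto (fun n => ξ (x n)) atTop (𝓝 (μ • z)) := by
  refine Metric.tendsto_nhds.2 fun ε hε => ?_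
  have hη : 0 < lam * (ε / 2) := by positivity
  have hsmall : (0 : EReal) < ((lam * (ε / 2)) ^ 2 / lam : ℝ) := by
    exact_mod_cast (by positivity : 0 < (lam * (ε / 2)) ^ 2 / lam)
  filter_upwards [hx.eventually (gt_mem_nhds hsmall)] with n hn
  set e := μ • z - ξ (x n) with he
  have hrange (y : E) : B' e (ξ y) ≤ lam * (ε / 2) * ‖ξ y‖ := by
    refine le_of_abs_le (le_of_eq_of_le ?_ ((dualNormSq_le_iff hlam hη.le).1 hn.le y))
    simp only [he, map_sub, map_smul, sub_apply, smul_apply, hz, hext, LinearMap.sub_apply,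
      LinearMap.smul_apply]
  have hdense : B' e e ≤ lam * (ε / 2) * ‖e‖ :=
    hξ.induction_on (p := fun w => B' e w ≤ lam * (ε / 2) * ‖w‖) e
      (isClosed_le (by fun_prop) (by fun_prop)) hrange
  have hle : ‖e‖ ≤ ε / 2 := by
    by_contra! hlt
    have := mul_lt_mul_of_pos_left hlt (mul_pos hlam ((half_pos hε).trans hlt))
    nlinarith [hB' e]
  rw [dist_comm, dist_eq_norm]
  linarith

lemma isEffectiveCoeff_of_mul_eq_one (hlam : 0 < lam) (hξ : DenseRange ξ)
    {B' : H →L[ℝ] H →L[ℝ] ℝ} (hext : ∀ x y, B' (ξ x) (ξ y) = B x y)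
    {z : H} (hz : ∀ y, B' z (ξ y) = δ y) {μ : ℝ} (hμ : μ * B' z z = 1) :
    IsEffectiveCoeff ξ lam B δ μ := by
  obtain ⟨u, hu_mem, hu⟩ := mem_closure_iff_seq_limit.1 (hξ (μ • z))
  choose x hx using hu_mem
  obtain rfl : (fun n => ξ (x n)) = u := funext hx
  have hδx : Tendsto (fun n => δ (x n)) atTop (𝓝 1) := by
    have h := ((B' z).continuous.tendsto (μ • z)).comp hu
    rw [map_smul, smul_eq_mul, hμ] at h
    exact h.congr fun n => hz (x n)
  obtain ⟨N, hN⟩ := (hδx.eventually_ne one_ne_zero).exists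
  let x' (n : ℕ) : E := x n + ((1 - δ (x n)) / δ (x N)) • x N
  have hx' : Tendsto (fun n => ξ (x' n)) atTop (𝓝 (μ • z)) := by
    have h := hu.add (((hδx.const_sub 1).div_const (δ (x N))).smul_const (ξ (x N)))
    rw [sub_self, zero_div, zero_smul, add_zero] at h
    exact h.congr fun n => by rw [map_add, map_smul]
  refine ⟨x', fun n => ?_, ?_⟩
  · rw [map_add, map_smul, smul_eq_mul, div_mul_cancel₀ _ hN, add_sub_cancel]
  set ε : ℕ → ℝ := fun n => ‖B'‖ * ‖μ • z - ξ (x' n)‖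
  have hε_lim : Tendsto (fun n => ((ε n ^ 2 / lam : ℝ) : EReal)) atTop (𝓝 0) := by
    have h := (((hx'.const_sub (μ • z)).norm.const_mul ‖B'‖).pow 2).div_const lam
    rw [sub_self, norm_zero, mul_zero, zero_pow two_ne_zero, zero_div] at h
    exact_mod_cast (continuous_coe_real_ereal.tendsto 0).comp h
  refine tendsto_of_tendsto_of_tendsto_of_le_of_le tendsto_const_nhds hε_lim
    (fun n => dualNormSq_nonneg) fun n => (dualNormSq_le_iff hlam (by positivity)).2 fun y => ?_
  have hdiff : (μ • δ - B (x' n)) y = B' (μ • z - ξ (x' n)) (ξ y) := by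
    simp only [map_sub, map_smul, sub_apply, smul_apply, hz, hext, LinearMap.sub_apply,
      LinearMap.smul_apply]
  rw [hdiff]
  exact B'.le_opNorm₂ _ _

lemma exists_isEffectiveCoeff_iff_of_denseRange [CompleteSpace H] (hlam : 0 < lam)
    (hξ : DenseRange ξ) (hbdd : ∃ C, ∀ x y, |B x y| ≤ C * ‖ξ x‖ * ‖ξ y‖)
    (hcoer : ∀ x, lam * ‖ξ x‖ ^ 2 ≤ B x x) (hδ : ∀ y, |δ y| ≤ C * ‖ξ y‖) (hδ0 : δ ≠ 0) :
    ∃ a, 0 < a ∧ lam * a ≤ C ^ 2 ∧ ∀ μ, IsEffectiveCoeff ξ lam B δ μ ↔ μ * a = 1 := by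
  obtain ⟨_, hbdd⟩ := hbdd
  obtain ⟨B', hext⟩ := exists_bilin_extension hξ hbdd
  have hB' (z : H) : lam * ‖z‖ ^ 2 ≤ B' z z :=
    hξ.induction_on (p := fun z => lam * ‖z‖ ^ 2 ≤ B' z z) z
      (isClosed_le (by fun_prop) (by fun_prop)) fun x => by rw [hext]; exact hcoer x
  obtain ⟨z, hz⟩ := exists_laxMilgram hlam hξ hB' hδ
  have hz0 : z ≠ 0 := by
    rintro rfl
    exact hδ0 (LinearMap.ext fun y => by rw [← hz, map_zero, zero_apply, LinearMap.zero_apply])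
  have hpos : 0 < B' z z :=
    (mul_pos hlam (pow_pos (norm_pos_iff.2 hz0) 2)).trans_le (hB' z)
  have hle : B' z z ≤ C * ‖z‖ :=
    hξ.induction_on (p := fun w => B' z w ≤ C * ‖w‖) z
      (isClosed_le (by fun_prop) (by fun_prop)) fun y => by
        rw [hz]; exact le_of_abs_le (hδ y)
  refine ⟨B' z z, hpos, ?_, fun μ => ⟨?_, isEffectiveCoeff_of_mul_eq_one hlam hξ hext hz⟩⟩
  · refine le_of_mul_le_mul_right ?_ hpos
    calc lam * B' z z * B' z z = lam * (B' z z) ^ 2 := by ring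
      _ ≤ lam * (C * ‖z‖) ^ 2 := by gcongr
      _ = C ^ 2 * (lam * ‖z‖ ^ 2) := by ring
      _ ≤ C ^ 2 * B' z z := by gcongr; exact hB' z
  · rintro ⟨x, hδx, hx⟩
    have hlim := ((B' z).continuous.tendsto _).comp
      (tendsto_of_isEffectiveCoeff hlam hξ hB' hext hz hx)
    rw [map_smul, smul_eq_mul] at hlim
    exact tendsto_nhds_unique hlim (tendsto_const_nhds.congr fun n => by
      rw [Function.comp_apply, hz, hδx])

lemma exists_isEffectiveCoeff_iff [CompleteSpace H] (hlam : 0 < lam)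
    (hbdd : ∃ C, ∀ x y, |B x y| ≤ C * ‖ξ x‖ * ‖ξ y‖) (hcoer : ∀ x, lam * ‖ξ x‖ ^ 2 ≤ B x x)
    (hδ : ∀ y, |δ y| ≤ C * ‖ξ y‖) (hδ0 : δ ≠ 0) :
    ∃ a, 0 < a ∧ lam * a ≤ C ^ 2 ∧ ∀ μ, IsEffectiveCoeff ξ lam B δ μ ↔ μ * a = 1 := by
  set K := (LinearMap.range ξ).topologicalClosure
  have hmem (x : E) : ξ x ∈ K := Submodule.le_topologicalClosure _ (LinearMap.mem_range_self ξ x)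
  have : CompleteSpace K := (Submodule.isClosed_topologicalClosure _).completeSpace_coe
  have hdense : DenseRange (ξ.codRestrict K hmem) := by
    rw [DenseRange, Subtype.dense_iff, ← Set.range_comp]
    exact fun _ h => h
  exact exists_isEffectiveCoeff_iff_of_denseRange (ξ := ξ.codRestrict K hmem) hlam hdense hbdd
    hcoer hδ hδ0

theorem existsUnique_isEffectiveCoeff [CompleteSpace H] (hlam : 0 < lam)
    (hbdd : ∃ C, ∀ x y, |B x y| ≤ C * ‖ξ x‖ * ‖ξ y‖) (hcoer : ∀ x, lam * ‖ξ x‖ ^ 2 ≤ B x x)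
    (hδ : ∀ y, |δ y| ≤ C * ‖ξ y‖) (hδ0 : δ ≠ 0) : ∃! μ, IsEffectiveCoeff ξ lam B δ μ := by
  obtain ⟨a, ha, -, hiff⟩ := exists_isEffectiveCoeff_iff hlam hbdd hcoer hδ hδ0
  simp only [hiff]
  exact ⟨a⁻¹, inv_mul_cancel₀ ha.ne', fun μ hμ => eq_inv_of_mul_eq_one_left hμ⟩

theorem div_sq_le_of_isEffectiveCoeff [CompleteSpace H] (hlam : 0 < lam)
    (hbdd : ∃ C, ∀ x y, |B x y| ≤ C * ‖ξ x‖ * ‖ξ y‖) (hcoer : ∀ x, lam * ‖ξ x‖ ^ 2 ≤ B x x)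
    (hδ : ∀ y, |δ y| ≤ C * ‖ξ y‖) (hδ0 : δ ≠ 0) {μ : ℝ} (hμ : IsEffectiveCoeff ξ lam B δ μ) :
    lam / C ^ 2 ≤ μ := by
  obtain ⟨a, ha, hle, hiff⟩ := exists_isEffectiveCoeff_iff hlam hbdd hcoer hδ hδ0
  rw [hiff] at hμ
  have hC : 0 < C ^ 2 := (mul_pos hlam ha).trans_le hle
  rw [div_le_iff₀ hC, eq_div_of_mul_eq ha.ne' hμ, one_div_mul_eq_div, le_div_iff₀ ha]
  exact hle

end Form

end LaxMilgram

lemma mul_sq_le_sub_of_mul_le_deriv {f : ℝ → ℝ} (hf : Differentiable ℝ f) {c : ℝ}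
    (h : ∀ x, 0 ≤ x → c * x ≤ deriv f x) {x : ℝ} (hx : 0 ≤ x) : c * x ^ 2 ≤ 2 * (f x - f 0) := by
  have hd (y : ℝ) : HasDerivAt (fun y => 2 * f y - c * y ^ 2) (2 * deriv f y - c * (2 * y)) y :=
    (((hf y).hasDerivAt.const_mul 2).sub ((hasDerivAt_pow 2 y).const_mul c)).congr_deriv (by simp)
  have hmono : MonotoneOn (fun y => 2 * f y - c * y ^ 2) (Set.Ici 0) := by
    refine monotoneOn_of_deriv_nonneg (convex_Ici 0)
      (fun y _ => (hd y).continuousAt.continuousWithinAt)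
      (fun y _ => (hd y).differentiableAt.differentiableWithinAt) fun y hy => ?_
    rw [interior_Ici] at hy
    rw [(hd y).deriv]
    linarith [h y hy.le]
  have := hmono Set.self_mem_Ici hx hx
  simp only [ne_eq, OfNat.ofNat_ne_zero, not_false_eq_true, zero_pow, mul_zero, sub_zero] at this
  linarith

namespace EnergyChain

variable (M : EnergyChain)

/-! ### The potential -/

lemma contDiff_deriv_V : ContDiff ℝ (⊤ : ℕ∞) (deriv M.V) :=
  (contDiff_infty_iff_deriv.1 M.V_smooth).2

lemma differentiable_V : Differentiable ℝ M.V := M.V_smooth.differentiable (by simp)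

lemma differentiable_deriv_V : Differentiable ℝ (deriv M.V) :=
  M.contDiff_deriv_V.differentiable (by simp)

lemma hasDerivAt_V (r : ℝ) : HasDerivAt M.V (deriv M.V r) r := (M.differentiable_V r).hasDerivAt

lemma hasDerivAt_deriv_V (r : ℝ) : HasDerivAt (deriv M.V) (deriv (deriv M.V) r) r :=
  (M.differentiable_deriv_V r).hasDerivAt

lemma δm_le_δp : M.δm ≤ M.δp := (M.le_V'' 0).trans (M.V''_le 0)

lemma δp_pos : 0 < M.δp := M.δm_pos.trans_le M.δm_le_δp

lemma deriv_V_neg (r : ℝ) : deriv M.V (-r) = -deriv M.V r := by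
  rw [← neg_eq_iff_eq_neg, ← deriv_comp_neg, funext M.V_symm]

@[simp] lemma deriv_V_zero : deriv M.V 0 = 0 := by
  have := M.deriv_V_neg 0
  rw [neg_zero] at this
  linarith

lemma le_deriv_V {r : ℝ} (hr : 0 ≤ r) : M.δm * r ≤ deriv M.V r := by
  simpa using mul_sub_le_image_sub_of_le_deriv M.differentiable_deriv_V M.le_V'' hr

lemma deriv_V_le {r : ℝ} (hr : 0 ≤ r) : deriv M.V r ≤ M.δp * r := by
  simpa using image_sub_le_mul_sub_of_deriv_le M.differentiable_deriv_V M.V''_le hr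

lemma abs_deriv_V_le (r : ℝ) : |deriv M.V r| ≤ M.δp * |r| := by
  have hV'' (x : ℝ) : ‖deriv (deriv M.V) x‖ ≤ M.δp := by
    rw [Real.norm_of_nonneg (M.δm_pos.le.trans (M.le_V'' x))]
    exact M.V''_le x
  simpa using convex_univ.norm_image_sub_le_of_norm_deriv_le
    (fun x _ => M.differentiable_deriv_V x) (fun x _ => hV'' x) (Set.mem_univ 0) (Set.mem_univ r)

lemma le_V_sub {r : ℝ} (hr : 0 ≤ r) : M.δm * r ^ 2 ≤ 2 * (M.V r - M.V 0) :=
  mul_sq_le_sub_of_mul_le_deriv M.differentiable_V (fun _ => M.le_deriv_V) hr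

lemma V_sub_le {r : ℝ} (hr : 0 ≤ r) : 2 * (M.V r - M.V 0) ≤ M.δp * r ^ 2 := by
  have := mul_sq_le_sub_of_mul_le_deriv (f := -M.V) (c := -M.δp) M.differentiable_V.neg
    (fun x hx => by rw [deriv.neg]; linarith [M.deriv_V_le hx]) hr
  simp only [Pi.neg_apply] at this
  linarith

/-! ### Straightening the energy levels into circles -/

/-- The coordinate `q`, odd in `r`, with `V = V 0 + q² / 2`. -/
def arc (r : ℝ) : ℝ := if 0 ≤ r then √(2 * (M.V r - M.V 0)) else -√(2 * (M.V r - M.V 0))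

lemma arc_of_nonneg {r : ℝ} (hr : 0 ≤ r) : M.arc r = √(2 * (M.V r - M.V 0)) := if_pos hr

lemma arc_neg (r : ℝ) : M.arc (-r) = -M.arc r := by
  unfold arc
  rw [M.V_symm]
  rcases lt_trichotomy r 0 with h | rfl | h
  · rw [if_pos (by linarith), if_neg (by linarith), neg_neg]
  · simp
  · rw [if_neg (by linarith), if_pos (by linarith)]

@[simp] lemma arc_zero : M.arc 0 = 0 := by simp [arc]

lemma le_arc {r : ℝ} (hr : 0 ≤ r) : √M.δm * r ≤ M.arc r := by
  rw [M.arc_of_nonneg hr]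
  refine Real.le_sqrt_of_sq_le ?_
  rw [mul_pow, Real.sq_sqrt M.δm_pos.le]
  exact M.le_V_sub hr

lemma arc_le {r : ℝ} (hr : 0 ≤ r) : M.arc r ≤ √M.δp * r := by
  rw [M.arc_of_nonneg hr]
  refine Real.sqrt_le_iff.2 ⟨by positivity, ?_⟩
  rw [mul_pow, Real.sq_sqrt M.δp_pos.le]
  exact M.V_sub_le hr

lemma arc_pos {r : ℝ} (hr : 0 < r) : 0 < M.arc r :=
  (mul_pos (Real.sqrt_pos.2 M.δm_pos) hr).trans_le (M.le_arc hr.le)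

lemma arc_sq (r : ℝ) : M.arc r ^ 2 = 2 * (M.V r - M.V 0) := by
  wlog hr : 0 ≤ r
  · rw [← neg_sq, ← arc_neg, ← M.V_symm r]
    exact this M (-r) (by linarith)
  rw [M.arc_of_nonneg hr]
  exact Real.sq_sqrt ((mul_nonneg M.δm_pos.le (sq_nonneg r)).trans (M.le_V_sub hr))

/-- The derivative of `arc`. -/
def arcDeriv (r : ℝ) : ℝ := if r = 0 then √(deriv (deriv M.V) 0) else deriv M.V r / M.arc r

lemma arcDeriv_neg (r : ℝ) : M.arcDeriv (-r) = M.arcDeriv r := by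
  simp [arcDeriv, arc_neg, deriv_V_neg, neg_div_neg_eq]

lemma le_arcDeriv (r : ℝ) : M.δm / √M.δp ≤ M.arcDeriv r := by
  wlog hr : 0 ≤ r
  · rw [← M.arcDeriv_neg]
    exact this M (-r) (by linarith)
  have hδp := Real.sqrt_pos.2 M.δp_pos
  rcases hr.eq_or_lt with rfl | hr
  · rw [arcDeriv, if_pos rfl, div_le_iff₀ hδp]
    calc M.δm = √M.δm * √M.δm := (Real.mul_self_sqrt M.δm_pos.le).symm
      _ ≤ √(deriv (deriv M.V) 0) * √M.δp := by
        gcongr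
        exacts [M.le_V'' 0, M.δm_le_δp]
  · rw [arcDeriv, if_neg hr.ne', div_le_div_iff₀ hδp (M.arc_pos hr)]
    calc M.δm * M.arc r ≤ M.δm * (√M.δp * r) := by
          gcongr
          exacts [M.δm_pos.le, M.arc_le hr.le]
      _ = M.δm * r * √M.δp := by ring
      _ ≤ deriv M.V r * √M.δp := by gcongr; exact M.le_deriv_V hr.le

lemma arcDeriv_pos (r : ℝ) : 0 < M.arcDeriv r :=
  (div_pos M.δm_pos (Real.sqrt_pos.2 M.δp_pos)).trans_le (M.le_arcDeriv r)

lemma hasDerivAt_arc_of_pos {r : ℝ} (hr : 0 < r) : HasDerivAt M.arc (M.arcDeriv r) r := by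
  have hV : 0 < 2 * (M.V r - M.V 0) := by
    rw [← M.arc_sq]
    exact pow_pos (M.arc_pos hr) 2
  have h := (((M.hasDerivAt_V r).sub_const (M.V 0)).const_mul 2).sqrt hV.ne'
  rw [← M.arc_of_nonneg hr.le, mul_div_mul_left _ _ two_ne_zero] at h
  rw [arcDeriv, if_neg hr.ne']
  refine h.congr_of_eventuallyEq ?_
  filter_upwards [lt_mem_nhds hr] with y hy
  exact M.arc_of_nonneg hy.le

lemma tendsto_V_sub_div_sq :
    Tendsto (fun x => 2 * (M.V x - M.V 0) / x ^ 2) (𝓝[≠] 0) (𝓝 (deriv (deriv M.V) 0)) := by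
  have hcont : Continuous M.V := M.differentiable_V.continuous
  refine HasDerivAt.lhopital_zero_nhdsNE (f' := fun x => 2 * deriv M.V x) (g' := fun x => 2 * x)
    (Eventually.of_forall fun x => ((M.hasDerivAt_V x).sub_const _).const_mul 2)
    (Eventually.of_forall fun x => by simpa using hasDerivAt_pow 2 x) ?_ ?_ ?_ ?_
  · filter_upwards [self_mem_nhdsWithin] with x hx
    simpa using hx
  · have h : Continuous fun x => 2 * (M.V x - M.V 0) := by fun_prop
    simpa using (h.tendsto 0).mono_left (nhdsWithin_le_nhds (s := {0}ᶜ))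
  · simpa using ((continuous_pow (M := ℝ) 2).tendsto 0).mono_left (nhdsWithin_le_nhds (s := {0}ᶜ))
  · refine (hasDerivAt_iff_tendsto_slope.1 (M.hasDerivAt_deriv_V 0)).congr fun x => ?_
    rw [slope_def_field, deriv_V_zero, sub_zero, sub_zero, mul_div_mul_left _ _ two_ne_zero]

lemma hasDerivAt_arc_zero : HasDerivAt M.arc (M.arcDeriv 0) 0 := by
  rw [arcDeriv, if_pos rfl, hasDerivAt_iff_tendsto_slope]
  refine ((Real.continuous_sqrt.tendsto _).comp M.tendsto_V_sub_div_sq).congr' ?_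
  filter_upwards [self_mem_nhdsWithin] with x hx
  rw [slope_def_field, arc_zero, sub_zero, sub_zero, Function.comp_apply,
    Real.sqrt_div' _ (sq_nonneg x), Real.sqrt_sq_eq_abs, arc]
  rcases lt_or_gt_of_ne (show x ≠ 0 from hx) with h | h
  · rw [if_neg (by linarith), abs_of_neg h, neg_div, div_neg]
  · rw [if_pos h.le, abs_of_pos h]

lemma hasDerivAt_arc (r : ℝ) : HasDerivAt M.arc (M.arcDeriv r) r := by
  rcases lt_trichotomy r 0 with h | rfl | h
  · have hneg := ((M.hasDerivAt_arc_of_pos (neg_pos.2 h)).comp r (hasDerivAt_neg r)).neg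
    have hodd : -(M.arc ∘ Neg.neg) = M.arc := funext fun y => by simp [arc_neg]
    rwa [hodd, arcDeriv_neg, mul_neg_one, neg_neg] at hneg
  · exact M.hasDerivAt_arc_zero
  · exact M.hasDerivAt_arc_of_pos h

lemma continuous_arc : Continuous M.arc :=
  continuous_iff_continuousAt.2 fun r => (M.hasDerivAt_arc r).continuousAt

lemma strictMono_arc : StrictMono M.arc :=
  strictMono_of_hasDerivAt_pos M.hasDerivAt_arc M.arcDeriv_pos

lemma surjective_arc : Function.Surjective M.arc := by
  have htop : Tendsto M.arc atTop atTop := by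
    refine tendsto_atTop_mono' _ ?_ (tendsto_id.const_mul_atTop (Real.sqrt_pos.2 M.δm_pos))
    filter_upwards [eventually_ge_atTop 0] with r hr
    exact M.le_arc hr
  have hbot : Tendsto M.arc atBot atBot :=
    (tendsto_neg_atTop_atBot.comp (htop.comp tendsto_neg_atBot_atTop)).congr fun r => by
      simp [arc_neg]
  exact M.continuous_arc.surjective htop hbot

/-- A change of variables `r = Q s` which turns the energy levels `p² / 2 + V(r) = const` into
circles in the `(p, s)`-plane. -/
structure Straightening where
  Q : ℝ → ℝ
  bound : ℝ
  bijective : Function.Bijective Q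
  differentiable : Differentiable ℝ Q
  deriv_pos : ∀ s, 0 < deriv Q s
  deriv_le : ∀ s, deriv Q s ≤ bound
  V_Q : ∀ s, M.V (Q s) = M.V 0 + s ^ 2 / 2

lemma nonempty_straightening : Nonempty M.Straightening := by
  let e := M.strictMono_arc.orderIsoOfSurjective _ M.surjective_arc
  have he (s : ℝ) : M.arc (e.symm s) = s := e.apply_symm_apply s
  have hderiv (s : ℝ) : HasDerivAt e.symm (M.arcDeriv (e.symm s))⁻¹ s :=
    HasDerivAt.of_local_left_inverse e.symm.continuous.continuousAt
      (M.hasDerivAt_arc _) (M.arcDeriv_pos _).ne' (Eventually.of_forall he)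
  exact ⟨{
    Q := e.symm
    bound := (M.δm / √M.δp)⁻¹
    bijective := e.symm.bijective
    differentiable := fun s => (hderiv s).differentiableAt
    deriv_pos := fun s => by
      rw [(hderiv s).deriv]
      exact inv_pos.2 (M.arcDeriv_pos _)
    deriv_le := fun s => by
      rw [(hderiv s).deriv]
      exact inv_anti₀ (div_pos M.δm_pos (Real.sqrt_pos.2 M.δp_pos)) (M.le_arcDeriv _)
    V_Q := fun s => by linarith [he s ▸ M.arc_sq (e.symm s)] }⟩

end EnergyChain

/-! ### An interpolation inequality for periodic functions -/

section Interval

lemma sq_integral_abs_le {α : Type*} [MeasurableSpace α] {μ : Measure α} [IsFiniteMeasure μ]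
    {f : α → ℝ} (hf : MemLp f 2 μ) : (∫ x, |f x| ∂μ) ^ 2 ≤ μ.real Set.univ * ∫ x, f x ^ 2 ∂μ := by
  have hint : Integrable f μ := hf.integrable one_le_two
  have hquad (t : ℝ) :
      0 ≤ μ.real Set.univ * (t * t) + (2 * ∫ x, |f x| ∂μ) * t + ∫ x, f x ^ 2 ∂μ := by
    have hlinear : Integrable (fun x => t ^ 2 + 2 * t * |f x|) μ :=
      (integrable_const _).add (hint.abs.const_mul _)
    calc 0 ≤ ∫ x, (t + |f x|) ^ 2 ∂μ := integral_nonneg fun x => sq_nonneg _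
      _ = ∫ x, (t ^ 2 + 2 * t * |f x| + f x ^ 2) ∂μ := by simp_rw [add_sq, sq_abs]
      _ = _ := by
        rw [integral_add hlinear hf.integrable_sq,
          integral_add (integrable_const _) (hint.abs.const_mul _), integral_const,
          integral_const_mul, smul_eq_mul]
        ring
  have := discrim_le_zero hquad
  rw [discrim] at this
  linarith

variable {F G : ℝ → ℝ} {a b : ℝ}

lemma setIntegral_Ioo_deriv_eq_sub (hab : a ≤ b) (hF : Differentiable ℝ F)
    (hint : IntegrableOn (deriv F) (Set.Ioo a b)) :
    ∫ t in Set.Ioo a b, deriv F t = F b - F a := by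
  rw [← integral_Ioc_eq_integral_Ioo, ← intervalIntegral.integral_of_le hab]
  exact intervalIntegral.integral_deriv_eq_sub (fun t _ => hF t)
    ((intervalIntegrable_iff_integrableOn_Ioo_of_le hab).2 hint)

lemma abs_sub_le_setIntegral_abs_deriv (hF : Differentiable ℝ F)
    (hint : IntegrableOn (deriv F) (Set.Ioo a b)) {t : ℝ} (ht : t ∈ Set.Ioo a b) :
    |F t - F a| ≤ ∫ t in Set.Ioo a b, |deriv F t| := by
  have hsub : Set.Ioo a t ⊆ Set.Ioo a b := Set.Ioo_subset_Ioo_right ht.2.le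
  rw [← setIntegral_Ioo_deriv_eq_sub ht.1.le hF (hint.mono_set hsub)]
  exact abs_integral_le_integral_abs.trans <| setIntegral_mono_set hint.abs
    (Eventually.of_forall fun t => abs_nonneg _) hsub.eventuallyLE

/-- As `deriv G` has average zero, `F` may be replaced by its oscillation. -/
lemma abs_setIntegral_mul_deriv_le_mul (hab : a ≤ b) (hF : Differentiable ℝ F)
    (hG : Differentiable ℝ G) (hGab : G a = G b) (hF' : IntegrableOn (deriv F) (Set.Ioo a b))
    (hG' : IntegrableOn (deriv G) (Set.Ioo a b)) :
    |∫ t in Set.Ioo a b, F t * deriv G t| ≤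
      (∫ t in Set.Ioo a b, |deriv F t|) * ∫ t in Set.Ioo a b, |deriv G t| := by
  have hFG : IntegrableOn (fun t => F t * deriv G t) (Set.Ioo a b) :=
    (((integrableOn_Icc_iff_integrableOn_Ioo ..).2 hG').continuousOn_mul hF.continuous.continuousOn
      isCompact_Icc).mono_set Set.Ioo_subset_Icc_self
  have hosc : IntegrableOn (fun t => (F t - F a) * deriv G t) (Set.Ioo a b) := by
    simp_rw [sub_mul]
    exact hFG.sub (hG'.const_mul _)
  have hcenter : ∫ t in Set.Ioo a b, F t * deriv G t =
      ∫ t in Set.Ioo a b, (F t - F a) * deriv G t := by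
    simp_rw [sub_mul]
    rw [integral_sub hFG (hG'.const_mul _), integral_const_mul,
      setIntegral_Ioo_deriv_eq_sub hab hG hG', hGab, sub_self, mul_zero, sub_zero]
  rw [hcenter, ← integral_const_mul]
  refine abs_integral_le_integral_abs.trans
    (setIntegral_mono_on hosc.abs (hG'.abs.const_mul _) measurableSet_Ioo fun t ht => ?_)
  rw [abs_mul]
  gcongr
  exact abs_sub_le_setIntegral_abs_deriv hF hF' ht

lemma abs_setIntegral_mul_deriv_le (hab : a ≤ b) (hF : Differentiable ℝ F)
    (hG : Differentiable ℝ G) (hGab : G a = G b)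
    (hF' : IntegrableOn (fun t => deriv F t ^ 2) (Set.Ioo a b))
    (hG' : IntegrableOn (fun t => deriv G t ^ 2) (Set.Ioo a b)) :
    |∫ t in Set.Ioo a b, F t * deriv G t| ≤
      (b - a) / 2 * ((∫ t in Set.Ioo a b, deriv F t ^ 2) + ∫ t in Set.Ioo a b, deriv G t ^ 2) := by
  have hF2 := (memLp_two_iff_integrable_sq (measurable_deriv F).aestronglyMeasurable).2 hF'
  have hG2 := (memLp_two_iff_integrable_sq (measurable_deriv G).aestronglyMeasurable).2 hG'
  have hsqF := sq_integral_abs_le hF2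
  have hsqG := sq_integral_abs_le hG2
  rw [measureReal_restrict_apply_univ, Real.volume_real_Ioo_of_le hab] at hsqF hsqG
  have hmul := abs_setIntegral_mul_deriv_le_mul hab hF hG hGab (hF2.integrable one_le_two)
    (hG2.integrable one_le_two)
  linarith [two_mul_le_add_sq (∫ t in Set.Ioo a b, |deriv F t|) (∫ t in Set.Ioo a b, |deriv G t|)]

end Interval

namespace EnergyChain

variable (M : EnergyChain)

/-! ### The Hamiltonian vector field of one site -/

/-- The Hamiltonian vector field `p ∂_r - V'(r) ∂_p` on functions of one pair `(p, r)`. -/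
def flowDeriv (f : ℝ × ℝ → ℝ) (x : ℝ × ℝ) : ℝ :=
  x.1 * deriv (fun t => f (x.1, t)) x.2 - deriv M.V x.2 * deriv (fun t => f (t, x.2)) x.1

variable {f g : ℝ × ℝ → ℝ}

lemma flowDeriv_eq_fderiv (hf : ContDiff ℝ 1 f) (x : ℝ × ℝ) :
    M.flowDeriv f x = fderiv ℝ f x (-deriv M.V x.2, x.1) := by
  have hd : HasFDerivAt f (fderiv ℝ f x) x := (hf.differentiable one_ne_zero x).hasFDerivAt
  have hr : HasDerivAt (fun t => f (x.1, t)) (fderiv ℝ f x (0, 1)) x.2 :=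
    HasFDerivAt.comp_hasDerivAt (f := fun t => (x.1, t)) x.2 hd
      ((hasDerivAt_const x.2 x.1).prodMk (hasDerivAt_id x.2))
  have hp : HasDerivAt (fun t => f (t, x.2)) (fderiv ℝ f x (1, 0)) x.1 :=
    HasFDerivAt.comp_hasDerivAt (f := fun t => (t, x.2)) x.1 hd
      ((hasDerivAt_id x.1).prodMk (hasDerivAt_const x.1 x.2))
  rw [flowDeriv, hr.deriv, hp.deriv, ← smul_eq_mul, ← smul_eq_mul, ← map_smul, ← map_smul,
    ← map_sub]
  simp

lemma continuous_flowDeriv (hf : ContDiff ℝ 1 f) : Continuous (M.flowDeriv f) := by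
  have hfderiv : Continuous fun x => fderiv ℝ f x := hf.continuous_fderiv one_ne_zero
  have hV' := M.differentiable_deriv_V.continuous
  rw [funext (M.flowDeriv_eq_fderiv hf)]
  fun_prop

/-- The radial part of the Gibbs measure in the polar coordinates of the `(p, s)`-plane. -/
def radialMeasure : Measure ℝ :=
  (volume.restrict (Set.Ioi 0)).withDensity fun ρ => ENNReal.ofReal
    (ρ * (Real.exp (-M.β * (M.V 0 + ρ ^ 2 / 2)) / (√(2 * Real.pi * M.β⁻¹) * M.Z)))

/-- The Lebesgue measure on angles. -/
def angleMeasure : Measure ℝ := volume.restrict (Set.Ioo (-Real.pi) Real.pi)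

instance : SFinite M.radialMeasure := by unfold radialMeasure; infer_instance

instance : IsFiniteMeasure angleMeasure := by unfold angleMeasure; infer_instance

namespace Straightening

variable {M} (T : M.Straightening)

lemma continuous : Continuous T.Q := T.differentiable.continuous

lemma deriv_mul_deriv_V (s : ℝ) : deriv T.Q s * deriv M.V (T.Q s) = s := by
  have hleft := (M.hasDerivAt_V (T.Q s)).comp s (T.differentiable s).hasDerivAt
  have hright : HasDerivAt (M.V ∘ T.Q) s s := by
    rw [show M.V ∘ T.Q = fun s => M.V 0 + s ^ 2 / 2 from funext T.V_Q]
    simpa using ((hasDerivAt_pow 2 s).div_const 2).const_add (M.V 0)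
  rw [mul_comm]
  exact hleft.unique hright

/-- Polar coordinates of the `(p, s)`-plane, `r = Q s`. -/
def polar (y : ℝ × ℝ) : ℝ × ℝ := (y.1 * Real.cos y.2, T.Q (y.1 * Real.sin y.2))

/-- The Jacobian `∂r / ∂s` at the point with polar coordinates `y`. -/
def weight (y : ℝ × ℝ) : ℝ := deriv T.Q (y.1 * Real.sin y.2)

lemma weight_pos (y : ℝ × ℝ) : 0 < T.weight y := T.deriv_pos _

lemma measurable_weight : Measurable T.weight :=
  (measurable_deriv T.Q).comp (by fun_prop : Measurable fun y : ℝ × ℝ => y.1 * Real.sin y.2)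

lemma measurable_polar : Measurable T.polar := by
  have := T.continuous
  exact (by unfold polar; fun_prop : Continuous T.polar).measurable

lemma energy_polar (y : ℝ × ℝ) : (T.polar y).1 ^ 2 / 2 + M.V (T.polar y).2 =
    M.V 0 + y.1 ^ 2 / 2 := by
  rw [polar, T.V_Q]
  linear_combination y.1 ^ 2 / 2 * Real.sin_sq_add_cos_sq y.2

lemma polar_neg_pi (ρ : ℝ) : T.polar (ρ, -Real.pi) = T.polar (ρ, Real.pi) := by
  simp [polar]

lemma lintegral_eq_lintegral_comp (g : ℝ → ENNReal) :
    ∫⁻ r, g r = ∫⁻ s, ENNReal.ofReal (deriv T.Q s) * g (T.Q s) := by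
  have h := lintegral_image_eq_lintegral_abs_deriv_mul (s := Set.univ) MeasurableSet.univ
    (fun s _ => (T.differentiable s).hasDerivAt.hasDerivWithinAt) T.bijective.1.injOn g
  simpa only [Set.image_univ, T.bijective.2.range_eq, Measure.restrict_univ,
    fun s => abs_of_pos (T.deriv_pos s)] using h

lemma lintegral_eq_lintegral_polar {g : ℝ × ℝ → ENNReal} (hg : Measurable g) :
    ∫⁻ x, g x = ∫⁻ y in polarCoord.target,
      ENNReal.ofReal y.1 * (ENNReal.ofReal (T.weight y) * g (T.polar y)) := by
  have hmeas : Measurable fun x : ℝ × ℝ =>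
      ENNReal.ofReal (deriv T.Q x.2) * g (x.1, T.Q x.2) := by
    have := T.continuous
    exact ((measurable_deriv T.Q).comp measurable_snd).ennreal_ofReal.mul
      (hg.comp (by fun_prop : Continuous fun x : ℝ × ℝ => (x.1, T.Q x.2)).measurable)
  calc ∫⁻ x, g x = ∫⁻ p, ∫⁻ r, g (p, r) := by
        rw [Measure.volume_eq_prod, lintegral_prod _ hg.aemeasurable]
    _ = ∫⁻ x : ℝ × ℝ, ENNReal.ofReal (deriv T.Q x.2) * g (x.1, T.Q x.2) := by
        rw [Measure.volume_eq_prod, lintegral_prod _ hmeas.aemeasurable]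
        exact lintegral_congr fun p => T.lintegral_eq_lintegral_comp _
    _ = _ := (lintegral_comp_polarCoord_symm _).symm

lemma siteMeasure_eq_map :
    M.siteMeasure = ((M.radialMeasure.prod angleMeasure).withDensity
      fun y => ENNReal.ofReal (T.weight y)).map T.polar := by
  have hV : Continuous M.V := M.differentiable_V.continuous
  have hsite : Measurable fun x : ℝ × ℝ => ENNReal.ofReal
      (Real.exp (-M.β * (x.1 ^ 2 / 2 + M.V x.2)) / (√(2 * Real.pi * M.β⁻¹) * M.Z)) :=
    (by fun_prop : Continuous _).measurable.ennreal_ofReal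
  have hradial : Measurable fun ρ : ℝ => ENNReal.ofReal
      (ρ * (Real.exp (-M.β * (M.V 0 + ρ ^ 2 / 2)) / (√(2 * Real.pi * M.β⁻¹) * M.Z))) :=
    (by fun_prop : Continuous _).measurable.ennreal_ofReal
  have hradial_fst : Measurable fun y : ℝ × ℝ => ENNReal.ofReal
      (y.1 * (Real.exp (-M.β * (M.V 0 + y.1 ^ 2 / 2)) / (√(2 * Real.pi * M.β⁻¹) * M.Z))) :=
    hradial.comp measurable_fst
  have hweight := T.measurable_weight.ennreal_ofReal
  refine Measure.ext_of_lintegral _ fun f hf => ?_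
  have hf_polar : Measurable fun y => f (T.polar y) := hf.comp T.measurable_polar
  rw [siteMeasure, lintegral_withDensity_eq_lintegral_mul _ hsite hf,
    T.lintegral_eq_lintegral_polar (hsite.mul hf), lintegral_map hf T.measurable_polar,
    lintegral_withDensity_eq_lintegral_mul _ hweight (g := fun y => f (T.polar y)) hf_polar,
    radialMeasure, angleMeasure, prod_withDensity_left hradial, Measure.prod_restrict,
    ← Measure.volume_eq_prod,
    lintegral_withDensity_eq_lintegral_mul _ hradial_fst (hweight.mul hf_polar)]
  refine setLIntegral_congr_fun (measurableSet_Ioi.prod measurableSet_Ioo) fun y hy => ?_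
  simp only [Pi.mul_apply]
  rw [T.energy_polar, ENNReal.ofReal_mul (le_of_lt hy.1)]
  ring

lemma integrable_siteMeasure_iff {h : ℝ × ℝ → ℝ} (hh : Measurable h) :
    Integrable h M.siteMeasure ↔
      Integrable (fun y => T.weight y * h (T.polar y)) (M.radialMeasure.prod angleMeasure) := by
  rw [T.siteMeasure_eq_map, integrable_map_measure hh.aestronglyMeasurable
    T.measurable_polar.aemeasurable, integrable_withDensity_iff_integrable_smul'
    T.measurable_weight.ennreal_ofReal (Eventually.of_forall fun _ => ENNReal.ofReal_lt_top)]
  simp only [ENNReal.toReal_ofReal (T.weight_pos _).le, Function.comp_apply, smul_eq_mul]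

lemma integral_siteMeasure_eq {h : ℝ × ℝ → ℝ} (hh : Measurable h) :
    ∫ x, h x ∂M.siteMeasure =
      ∫ y, T.weight y * h (T.polar y) ∂(M.radialMeasure.prod angleMeasure) := by
  rw [T.siteMeasure_eq_map, integral_map T.measurable_polar.aemeasurable
    hh.aestronglyMeasurable, integral_withDensity_eq_integral_toReal_smul
    T.measurable_weight.ennreal_ofReal (Eventually.of_forall fun _ => ENNReal.ofReal_lt_top)]
  simp only [ENNReal.toReal_ofReal (T.weight_pos _).le, smul_eq_mul]

lemma hasDerivAt_comp_polar (hf : ContDiff ℝ 1 f) (ρ θ : ℝ) :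
    HasDerivAt (fun θ => f (T.polar (ρ, θ)))
      (T.weight (ρ, θ) * M.flowDeriv f (T.polar (ρ, θ))) θ := by
  have hpolar : HasDerivAt (fun θ => T.polar (ρ, θ))
      (ρ * -Real.sin θ, T.weight (ρ, θ) * (ρ * Real.cos θ)) θ :=
    ((Real.hasDerivAt_cos θ).const_mul ρ).prodMk
      ((T.differentiable _).hasDerivAt.comp θ ((Real.hasDerivAt_sin θ).const_mul ρ))
  have htangent : ((ρ * -Real.sin θ, T.weight (ρ, θ) * (ρ * Real.cos θ)) : ℝ × ℝ) =
      T.weight (ρ, θ) • (-deriv M.V (T.polar (ρ, θ)).2, (T.polar (ρ, θ)).1) := by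
    ext
    · simp [polar, weight, T.deriv_mul_deriv_V]
    · simp [polar]
  have h := ((hf.differentiable one_ne_zero _).hasFDerivAt (x := T.polar (ρ, θ))).comp_hasDerivAt θ
    hpolar
  rwa [htangent, map_smul, smul_eq_mul, ← M.flowDeriv_eq_fderiv hf] at h

lemma deriv_comp_polar (hf : ContDiff ℝ 1 f) (ρ : ℝ) :
    deriv (fun θ => f (T.polar (ρ, θ))) =
      fun θ => T.weight (ρ, θ) * M.flowDeriv f (T.polar (ρ, θ)) :=
  funext fun θ => (T.hasDerivAt_comp_polar hf ρ θ).deriv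

lemma sq_deriv_comp_polar_le (hf : ContDiff ℝ 1 f) (ρ θ : ℝ) :
    deriv (fun θ => f (T.polar (ρ, θ))) θ ^ 2 ≤
      T.bound * (T.weight (ρ, θ) * M.flowDeriv f (T.polar (ρ, θ)) ^ 2) := by
  have hnonneg : 0 ≤ T.weight (ρ, θ) * M.flowDeriv f (T.polar (ρ, θ)) ^ 2 :=
    mul_nonneg (T.weight_pos _).le (sq_nonneg _)
  rw [T.deriv_comp_polar hf, mul_pow, sq (T.weight (ρ, θ)), mul_assoc]
  exact mul_le_mul_of_nonneg_right (T.deriv_le _) hnonneg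

lemma integrable_sq_deriv_comp_polar (hf : ContDiff ℝ 1 f) {ρ : ℝ}
    (hint : Integrable (fun θ => T.weight (ρ, θ) * M.flowDeriv f (T.polar (ρ, θ)) ^ 2)
      angleMeasure) :
    Integrable (fun θ => deriv (fun θ => f (T.polar (ρ, θ))) θ ^ 2) angleMeasure := by
  refine (hint.const_mul T.bound).mono'
    ((measurable_deriv _).pow_const 2).aestronglyMeasurable (Eventually.of_forall fun θ => ?_)
  rw [Real.norm_of_nonneg (sq_nonneg _)]
  exact T.sq_deriv_comp_polar_le hf ρ θ

lemma integral_sq_deriv_comp_polar_le (hf : ContDiff ℝ 1 f) {ρ : ℝ}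
    (hint : Integrable (fun θ => T.weight (ρ, θ) * M.flowDeriv f (T.polar (ρ, θ)) ^ 2)
      angleMeasure) :
    ∫ θ, deriv (fun θ => f (T.polar (ρ, θ))) θ ^ 2 ∂angleMeasure ≤
      T.bound * ∫ θ, T.weight (ρ, θ) * M.flowDeriv f (T.polar (ρ, θ)) ^ 2 ∂angleMeasure := by
  rw [← integral_const_mul]
  exact integral_mono (T.integrable_sq_deriv_comp_polar hf hint) (hint.const_mul _)
    (T.sq_deriv_comp_polar_le hf ρ)

lemma abs_integral_angle_le (hf : ContDiff ℝ 1 f) (hg : ContDiff ℝ 1 g) {ρ : ℝ}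
    (hf2 : Integrable (fun θ => T.weight (ρ, θ) * M.flowDeriv f (T.polar (ρ, θ)) ^ 2) angleMeasure)
    (hg2 : Integrable (fun θ => T.weight (ρ, θ) * M.flowDeriv g (T.polar (ρ, θ)) ^ 2)
      angleMeasure) :
    |∫ θ, T.weight (ρ, θ) * (f (T.polar (ρ, θ)) * M.flowDeriv g (T.polar (ρ, θ))) ∂angleMeasure| ≤
      Real.pi * T.bound *
        ((∫ θ, T.weight (ρ, θ) * M.flowDeriv f (T.polar (ρ, θ)) ^ 2 ∂angleMeasure) +
          ∫ θ, T.weight (ρ, θ) * M.flowDeriv g (T.polar (ρ, θ)) ^ 2 ∂angleMeasure) := by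
  have hcircle := abs_setIntegral_mul_deriv_le (neg_le_self Real.pi_pos.le)
    (fun θ => (T.hasDerivAt_comp_polar hf ρ θ).differentiableAt)
    (fun θ => (T.hasDerivAt_comp_polar hg ρ θ).differentiableAt)
    (by rw [T.polar_neg_pi]) (T.integrable_sq_deriv_comp_polar hf hf2)
    (T.integrable_sq_deriv_comp_polar hg hg2)
  simp_rw [mul_left_comm (T.weight _), ← congrFun (T.deriv_comp_polar hg ρ)]
  calc _ ≤ _ := hcircle
    _ ≤ (Real.pi - -Real.pi) / 2 * (T.bound * _ + T.bound * _) := by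
      gcongr
      · linarith [Real.pi_pos]
      · exact T.integral_sq_deriv_comp_polar_le hf hf2
      · exact T.integral_sq_deriv_comp_polar_le hg hg2
    _ = _ := by ring

end Straightening

lemma integral_flowDeriv (hf : ContDiff ℝ 1 f)
    (hint : Integrable (M.flowDeriv f) M.siteMeasure) :
    ∫ x, M.flowDeriv f x ∂M.siteMeasure = 0 := by
  obtain ⟨T⟩ := M.nonempty_straightening
  have hmeas := (M.continuous_flowDeriv hf).measurable
  rw [T.integrable_siteMeasure_iff hmeas] at hint
  rw [T.integral_siteMeasure_eq hmeas, integral_prod _ hint]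
  refine integral_eq_zero_of_ae ?_
  filter_upwards [hint.prod_right_ae] with ρ hρ
  simp only [← congrFun (T.deriv_comp_polar hf ρ)] at hρ ⊢
  rw [angleMeasure, setIntegral_Ioo_deriv_eq_sub (neg_le_self Real.pi_pos.le)
    (fun θ => (T.hasDerivAt_comp_polar hf ρ θ).differentiableAt) hρ, T.polar_neg_pi, sub_self,
    Pi.zero_apply]

/-- The interpolation inequality is applied on each energy level, a periodic orbit of the flow. -/
lemma exists_sector_site : ∃ C : ℝ, 0 ≤ C ∧ ∀ f g : ℝ × ℝ → ℝ, ContDiff ℝ 1 f → ContDiff ℝ 1 g →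
    Integrable (fun x => f x * M.flowDeriv g x) M.siteMeasure →
    Integrable (fun x => M.flowDeriv f x ^ 2) M.siteMeasure →
    Integrable (fun x => M.flowDeriv g x ^ 2) M.siteMeasure →
    |∫ x, f x * M.flowDeriv g x ∂M.siteMeasure| ≤
      C * ((∫ x, M.flowDeriv f x ^ 2 ∂M.siteMeasure) +
        ∫ x, M.flowDeriv g x ^ 2 ∂M.siteMeasure) := by
  obtain ⟨T⟩ := M.nonempty_straightening
  have hbound : 0 ≤ T.bound := (T.deriv_pos 0).le.trans (T.deriv_le 0)
  refine ⟨Real.pi * T.bound, by positivity, fun f g hf hg hfg hf2 hg2 => ?_⟩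
  have hmf := (M.continuous_flowDeriv hf).measurable
  have hmg := (M.continuous_flowDeriv hg).measurable
  have hmfg : Measurable fun x => f x * M.flowDeriv g x := hf.continuous.measurable.mul hmg
  rw [T.integrable_siteMeasure_iff hmfg] at hfg
  rw [T.integrable_siteMeasure_iff (hmf.pow_const 2)] at hf2
  rw [T.integrable_siteMeasure_iff (hmg.pow_const 2)] at hg2
  rw [T.integral_siteMeasure_eq hmfg, T.integral_siteMeasure_eq (hmf.pow_const 2),
    T.integral_siteMeasure_eq (hmg.pow_const 2), integral_prod _ hfg, integral_prod _ hf2,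
    integral_prod _ hg2, ← integral_add hf2.integral_prod_left hg2.integral_prod_left,
    ← integral_const_mul]
  refine abs_integral_le_integral_abs.trans (integral_mono_ae hfg.integral_prod_left.abs
    ((hf2.integral_prod_left.add hg2.integral_prod_left).const_mul _) ?_)
  filter_upwards [hf2.prod_right_ae, hg2.prod_right_ae] with ρ hf2ρ hg2ρ
  exact T.abs_integral_angle_le hf hg hf2ρ hg2ρ

end EnergyChain

/-! ### Product structure and invariances of the Gibbs measure -/

lemma measurePreserving_update_infinitePi {ι : Type*} [DecidableEq ι] {S : ι → Type*}
    [∀ i, MeasurableSpace (S i)] (μ : ∀ i, Measure (S i)) [∀ i, IsProbabilityMeasure (μ i)]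
    (i : ι) :
    MeasurePreserving (fun y : (∀ i, S i) × S i => Function.update y.1 i y.2)
      ((Measure.infinitePi μ).prod (μ i)) (Measure.infinitePi μ) := by
  refine ⟨measurable_update', Measure.eq_infinitePi _ fun s t ht => ?_⟩
  have hpre : (fun y : (∀ i, S i) × S i => Function.update y.1 i y.2) ⁻¹' (s : Set ι).pi t =
      ((s.erase i : Finset ι) : Set ι).pi t ×ˢ (if i ∈ s then t i else Set.univ) := by
    ext y
    have hforall := Function.forall_update_iff y.1 (a := i) (b := y.2) fun k v => k ∈ s → v ∈ t k
    by_cases hi : i ∈ s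
    · simp_all [Set.mem_pi, and_comm]
    · simp_all only [Set.mem_preimage, Set.mem_pi, Finset.mem_coe, Finset.erase_eq_of_notMem,
        not_false_eq_true, if_false, Set.mem_prod, Set.mem_univ, and_true, false_imp_iff,
        true_and]
      exact forall_congr' fun k => ⟨fun h hk => h (ne_of_mem_of_not_mem hk hi) hk, fun h _ => h⟩
  rw [Measure.map_apply measurable_update' (.pi s.countable_toSet fun _ _ => ht _), hpre,
    Measure.prod_prod, Measure.infinitePi_pi _ fun k _ => ht k]
  split_ifs with hi
  · rw [mul_comm, Finset.mul_prod_erase s (fun k => μ k (t k)) hi]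
  · rw [measure_univ, mul_one, Finset.erase_eq_of_notMem hi]

lemma measurePreserving_of_comp {α β γ : Type*} [MeasurableSpace α] [MeasurableSpace β]
    [MeasurableSpace γ] {μ : Measure α} {ν : Measure β} {ρ : Measure γ} {g : α → β} {f : β → γ}
    (hg : MeasurePreserving g μ ν) (hf : Measurable f) (hfg : MeasurePreserving (f ∘ g) μ ρ) :
    MeasurePreserving f ν ρ :=
  ⟨hf, by rw [← hg.map_eq, Measure.map_map hf hg.measurable, hfg.map_eq]⟩

namespace EnergyChain

variable (M : EnergyChain)

instance : IsProbabilityMeasure M.gibbs := by unfold gibbs; infer_instance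

/-- The law of `r` at one site. -/
def posMeasure : Measure ℝ :=
  volume.withDensity fun r => ENNReal.ofReal (Real.exp (-M.β * M.V r) / M.Z)

/-- The law of `p` at one site. -/
def momMeasure : Measure ℝ := ProbabilityTheory.gaussianReal 0 M.β⁻¹.toNNReal

instance : IsProbabilityMeasure M.momMeasure := by unfold momMeasure; infer_instance

instance : SFinite M.posMeasure := by unfold posMeasure; infer_instance

lemma siteMeasure_eq_prod : M.siteMeasure = M.momMeasure.prod M.posMeasure := by
  have hβ := M.β_pos
  have hv : M.β⁻¹.toNNReal ≠ 0 := (Real.toNNReal_pos.2 (inv_pos.2 hβ)).ne'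
  have hV : Continuous M.V := M.differentiable_V.continuous
  have hsqrt : √(2 * Real.pi * M.β⁻¹) ≠ 0 := (Real.sqrt_pos.2 (by positivity)).ne'
  have hZ := M.Z_pos.ne'
  rw [momMeasure, ProbabilityTheory.gaussianReal_of_var_ne_zero _ hv, posMeasure,
    prod_withDensity (ProbabilityTheory.measurable_gaussianPDF _ _)
      (Measurable.ennreal_ofReal (Continuous.measurable (by fun_prop))),
    ← Measure.volume_eq_prod, siteMeasure]
  congr 1
  funext x
  have hexp : Real.exp (-M.β * (x.1 ^ 2 / 2 + M.V x.2)) =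
      Real.exp (-(x.1 - 0) ^ 2 / (2 * M.β⁻¹)) * Real.exp (-M.β * M.V x.2) := by
    rw [← Real.exp_add]
    congr 1
    field_simp
    ring
  rw [ProbabilityTheory.gaussianPDF, ← ENNReal.ofReal_mul
    (ProbabilityTheory.gaussianPDFReal_nonneg _ _ _), ProbabilityTheory.gaussianPDFReal, hexp,
    Real.coe_toNNReal _ (inv_pos.2 hβ).le]
  congr 1
  field_simp

instance : IsProbabilityMeasure M.posMeasure := by
  have hmap : M.siteMeasure.map Prod.snd = M.posMeasure := by
    rw [siteMeasure_eq_prod, Measure.map_snd_prod, measure_univ, one_smul]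
  exact hmap ▸ Measure.isProbabilityMeasure_map measurable_snd.aemeasurable

lemma measurePreserving_update (i : ℤ) :
    MeasurePreserving (fun y : Config × (ℝ × ℝ) => Function.update y.1 i y.2)
      (M.gibbs.prod M.siteMeasure) M.gibbs :=
  measurePreserving_update_infinitePi (fun _ : ℤ => M.siteMeasure) i

lemma measurable_update_config {α : Type*} [MeasurableSpace α] {f : α → Config}
    {x : α → ℝ × ℝ} (i : ℤ) (hf : Measurable f) (hx : Measurable x) :
    Measurable fun a => Function.update (f a) i (x a) :=
  measurable_update'.comp (hf.prodMk hx)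

lemma measurePreserving_update_mom (i : ℤ) :
    MeasurePreserving (fun y : Config × ℝ => Function.update y.1 i (y.2, (y.1 i).2))
      (M.gibbs.prod M.momMeasure) M.gibbs := by
  have hsite : MeasurePreserving (fun y : (ℝ × ℝ) × ℝ => (y.2, y.1.2))
      (M.siteMeasure.prod M.momMeasure) M.siteMeasure := by
    rw [siteMeasure_eq_prod]
    exact Measure.measurePreserving_swap.comp
      ((measurePreserving_snd (μ := M.momMeasure) (ν := M.posMeasure)).prod
        (MeasurePreserving.id M.momMeasure))
  refine measurePreserving_of_comp
    ((M.measurePreserving_update i).prod (MeasurePreserving.id M.momMeasure))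
    (measurable_update_config i measurable_fst (by fun_prop)) ?_
  convert (M.measurePreserving_update i).comp (((MeasurePreserving.id M.gibbs).prod hsite).comp
    (measurePreserving_prodAssoc M.gibbs M.siteMeasure M.momMeasure)) using 1
  funext y
  simp [MeasurableEquiv.prodAssoc]

lemma measurePreserving_update_pos (i : ℤ) :
    MeasurePreserving (fun y : Config × ℝ => Function.update y.1 i ((y.1 i).1, y.2))
      (M.gibbs.prod M.posMeasure) M.gibbs := by
  have hsite : MeasurePreserving (fun y : (ℝ × ℝ) × ℝ => (y.1.1, y.2))
      (M.siteMeasure.prod M.posMeasure) M.siteMeasure := by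
    rw [siteMeasure_eq_prod]
    exact measurePreserving_fst.prod (MeasurePreserving.id _)
  refine measurePreserving_of_comp
    ((M.measurePreserving_update i).prod (MeasurePreserving.id M.posMeasure))
    (measurable_update_config i measurable_fst (by fun_prop)) ?_
  convert (M.measurePreserving_update i).comp (((MeasurePreserving.id M.gibbs).prod hsite).comp
    (measurePreserving_prodAssoc M.gibbs M.siteMeasure M.posMeasure)) using 1
  funext y
  simp [MeasurableEquiv.prodAssoc]

/-- The configuration `ω` with `p_i` and `r_j` replaced by the coordinates of `x`. -/
def resample (i j : ℤ) (ω : Config) (x : ℝ × ℝ) : Config := fun k =>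
  (if k = i then x.1 else (ω k).1, if k = j then x.2 else (ω k).2)

lemma resample_eq_update (i j : ℤ) (ω : Config) (x : ℝ × ℝ) :
    resample i j ω x = Function.update (Function.update ω i (x.1, (ω i).2)) j
      ((Function.update ω i (x.1, (ω i).2) j).1, x.2) := by
  funext k
  simp only [resample, Function.update_apply]
  grind

lemma measurePreserving_resample (i j : ℤ) :
    MeasurePreserving (fun y : Config × (ℝ × ℝ) => resample i j y.1 y.2)
      (M.gibbs.prod M.siteMeasure) M.gibbs := by
  simp only [resample_eq_update, siteMeasure_eq_prod]
  exact ((M.measurePreserving_update_pos j).comp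
    ((M.measurePreserving_update_mom i).prod (MeasurePreserving.id M.posMeasure))).comp
      (measurePreserving_prodAssoc M.gibbs M.momMeasure M.posMeasure).symm

lemma integrable_resample {F : Config → ℝ} (i j : ℤ) (hF : Integrable F M.gibbs) :
    Integrable (fun y : Config × (ℝ × ℝ) => F (resample i j y.1 y.2))
      (M.gibbs.prod M.siteMeasure) :=
  (M.measurePreserving_resample i j).integrable_comp_of_integrable hF

lemma integral_resample {F : Config → ℝ} (i j : ℤ) (hF : Integrable F M.gibbs) :
    ∫ ω, F ω ∂M.gibbs = ∫ ω, ∫ x, F (resample i j ω x) ∂M.siteMeasure ∂M.gibbs := by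
  have h := M.measurePreserving_resample i j
  have hmeas := hF.aestronglyMeasurable
  rw [← h.map_eq] at hmeas
  rw [← integral_prod _ (M.integrable_resample i j hF),
    ← integral_map h.measurable.aemeasurable hmeas, h.map_eq]

lemma measurePreserving_shift (j : ℤ) :
    MeasurePreserving (MeasurableEquiv.piCongrLeft (fun _ : ℤ => ℝ × ℝ) (Equiv.subRight j))
      M.gibbs M.gibbs :=
  ⟨MeasurableEquiv.measurable _,
    Measure.infinitePi_map_piCongrLeft (fun _ : ℤ => M.siteMeasure) (Equiv.subRight j)⟩

lemma shift_eq_comp (j : ℤ) (F : Config → ℝ) :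
    shift j F = F ∘ MeasurableEquiv.piCongrLeft (fun _ : ℤ => ℝ × ℝ) (Equiv.subRight j) := by
  funext ω
  refine congrArg F (funext fun i => ?_)
  have h := Equiv.piCongrLeft_apply_apply (fun _ : ℤ => ℝ × ℝ) (Equiv.subRight j) ω (i + j)
  rw [Equiv.subRight_apply, add_sub_cancel_right] at h
  exact h.symm

lemma integral_shift (j : ℤ) (F : Config → ℝ) :
    ∫ ω, shift j F ω ∂M.gibbs = ∫ ω, F ω ∂M.gibbs := by
  rw [shift_eq_comp]
  exact (M.measurePreserving_shift j).integral_comp' F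

end EnergyChain

/-! ### Functions with finite moments of all orders -/

section MomentAlgebra

variable {Ω : Type*} [MeasurableSpace Ω] (μ : Measure Ω) [IsFiniteMeasure μ]

/-- The algebra of functions with finite moments of all orders. -/
def momentAlgebra : Subalgebra ℝ (Ω → ℝ) where
  carrier := {F | ∀ q : ℕ, MemLp F q μ}
  mul_mem' {F G} hF hG q := by
    have : ENNReal.HolderTriple ((2 * q : ℕ) : ENNReal) ((2 * q : ℕ) : ENNReal) q :=
      ⟨by rw [Nat.cast_mul, Nat.cast_two, ENNReal.mul_inv (by simp) (by simp), ← add_mul,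
        ENNReal.inv_two_add_inv_two, one_mul]⟩
    exact (hG (2 * q)).mul (hF (2 * q))
  add_mem' hF hG q := (hF q).add (hG q)
  algebraMap_mem' c _ := memLp_const c

variable {μ} {F G : Ω → ℝ}

lemma mem_momentAlgebra_of_abs_le (hG : G ∈ momentAlgebra μ) (hF : Measurable F)
    (h : ∀ ω, |F ω| ≤ |G ω|) : F ∈ momentAlgebra μ :=
  fun q => (hG q).mono hF.aestronglyMeasurable (Eventually.of_forall h)

lemma mem_momentAlgebra_of_bounded (hF : Measurable F) {C : ℝ} (h : ∀ ω, |F ω| ≤ C) :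
    F ∈ momentAlgebra μ :=
  fun _ => .of_bound hF.aestronglyMeasurable C (Eventually.of_forall h)

lemma comp_mem_momentAlgebra {Ω' : Type*} [MeasurableSpace Ω'] {ν : Measure Ω'}
    [IsFiniteMeasure ν] {f : Ω' → Ω} (hF : F ∈ momentAlgebra μ) (hf : MeasurePreserving f ν μ) :
    F ∘ f ∈ momentAlgebra ν :=
  fun q => (hF q).comp_measurePreserving hf

lemma memLp_two_of_mem_momentAlgebra (hF : F ∈ momentAlgebra μ) : MemLp F 2 μ :=
  mod_cast hF 2

end MomentAlgebra

namespace EnergyChain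

variable (M : EnergyChain)

lemma measurePreserving_mom (i : ℤ) :
    MeasurePreserving (fun ω : Config => (ω i).1) M.gibbs M.momMeasure := by
  have hfst : MeasurePreserving Prod.fst M.siteMeasure M.momMeasure := by
    rw [siteMeasure_eq_prod]
    exact measurePreserving_fst
  exact hfst.comp (measurePreserving_eval_infinitePi (fun _ : ℤ => M.siteMeasure) i)

lemma measurePreserving_pos (i : ℤ) :
    MeasurePreserving (fun ω : Config => (ω i).2) M.gibbs M.posMeasure := by
  have hsnd : MeasurePreserving Prod.snd M.siteMeasure M.posMeasure := by
    rw [siteMeasure_eq_prod]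
    exact measurePreserving_snd
  exact hsnd.comp (measurePreserving_eval_infinitePi (fun _ : ℤ => M.siteMeasure) i)

lemma id_mem_momentAlgebra_momMeasure : id ∈ momentAlgebra M.momMeasure :=
  fun q => ProbabilityTheory.memLp_id_gaussianReal (q : NNReal)

lemma integrable_pow_posMeasure (n : ℕ) : Integrable (fun r : ℝ => |r| ^ n) M.posMeasure := by
  have hV : Continuous M.V := M.differentiable_V.continuous
  have hdensity (r : ℝ) : 0 ≤ Real.exp (-M.β * M.V r) / M.Z :=
    div_nonneg (Real.exp_pos _).le M.Z_pos.le
  rw [posMeasure, integrable_withDensity_iff_integrable_smul'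
    (Measurable.ennreal_ofReal (Continuous.measurable (by fun_prop)))
    (Eventually.of_forall fun _ => ENNReal.ofReal_lt_top)]
  simp only [ENNReal.toReal_ofReal (hdensity _), smul_eq_mul]
  have hgauss := (integrable_rpow_mul_exp_neg_mul_sq
    (mul_pos M.β_pos (half_pos M.δm_pos)) (s := n) (by linarith [n.cast_nonneg (α := ℝ)])).norm
  refine (hgauss.div_const M.Z).mono' (by fun_prop) (Eventually.of_forall fun r => ?_)
  have hexp : Real.exp (-M.β * M.V r) ≤ Real.exp (-(M.β * (M.δm / 2)) * r ^ 2) := by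
    refine Real.exp_le_exp.2 ?_
    linarith [mul_le_mul_of_nonneg_left (M.le_V r) M.β_pos.le]
  rw [norm_mul, Real.norm_of_nonneg (hdensity r), norm_pow, norm_mul, Real.rpow_natCast, norm_pow,
    Real.norm_of_nonneg (Real.exp_pos _).le, Real.norm_eq_abs, abs_abs, div_mul_eq_mul_div,
    mul_comm (‖r‖ ^ n)]
  have := M.Z_pos.le
  gcongr
  exact (Real.norm_eq_abs r).ge

lemma id_mem_momentAlgebra_posMeasure : id ∈ momentAlgebra M.posMeasure := by
  intro q
  rcases eq_or_ne q 0 with rfl | hq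
  · simpa using measurable_id.aestronglyMeasurable
  · refine (integrable_norm_rpow_iff measurable_id.aestronglyMeasurable
      (Nat.cast_ne_zero.2 hq) (by simp)).1 ?_
    simpa using M.integrable_pow_posMeasure q

lemma mom_mem_momentAlgebra (i : ℤ) : (fun ω : Config => (ω i).1) ∈ momentAlgebra M.gibbs :=
  comp_mem_momentAlgebra (F := id) M.id_mem_momentAlgebra_momMeasure (M.measurePreserving_mom i)

lemma comp_pos_mem_momentAlgebra {f : ℝ → ℝ} (hf : f ∈ momentAlgebra M.posMeasure) (i : ℤ) :
    (fun ω : Config => f (ω i).2) ∈ momentAlgebra M.gibbs :=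
  comp_mem_momentAlgebra hf (M.measurePreserving_pos i)

lemma deriv_V_mem_momentAlgebra : deriv M.V ∈ momentAlgebra M.posMeasure :=
  mem_momentAlgebra_of_abs_le (G := M.δp • id) (Subalgebra.smul_mem _
    M.id_mem_momentAlgebra_posMeasure _) M.contDiff_deriv_V.continuous.measurable fun r => by
      simpa [abs_mul, abs_of_pos M.δp_pos] using M.abs_deriv_V_le r

lemma deriv_deriv_V_mem_momentAlgebra : deriv (deriv M.V) ∈ momentAlgebra M.posMeasure :=
  mem_momentAlgebra_of_bounded (measurable_deriv _) (C := M.δp) fun r => by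
    rw [abs_of_nonneg (M.δm_pos.le.trans (M.le_V'' r))]
    exact M.V''_le r

lemma V_mem_momentAlgebra : M.V ∈ momentAlgebra M.posMeasure := by
  refine mem_momentAlgebra_of_abs_le (G := (M.δp / 2) • id ^ 2 + algebraMap ℝ (ℝ → ℝ) (M.V 0))
    (add_mem (Subalgebra.smul_mem _ (pow_mem M.id_mem_momentAlgebra_posMeasure 2) _)
      (Subalgebra.algebraMap_mem _ _)) M.differentiable_V.continuous.measurable fun r => ?_
  have hle : M.V r ≤ M.δp / 2 * r ^ 2 + M.V 0 := by
    wlog hr : 0 ≤ r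
    · simpa [M.V_symm] using this M (-r) (by linarith)
    linarith [M.V_sub_le hr]
  rw [abs_of_nonneg (M.V_nonneg r)]
  exact hle.trans (le_abs_self _)

end EnergyChain

namespace EnergyChain

variable {F G : Config → ℝ}

/-! ### Calculus of smooth local functions -/

/-- The coordinate `p_i`. -/
def mom (i : ℤ) : Config → ℝ := fun ω => (ω i).1

/-- The coordinate `r_i`. -/
def pos (i : ℤ) : Config → ℝ := fun ω => (ω i).2

/-- The function `V'(r_i)`. -/
def force (M : EnergyChain) (i : ℤ) : Config → ℝ := fun ω => deriv M.V (ω i).2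

lemma exists_dependsOn (hF : IsSmoothLocal F) : ∃ Λ : Finset ℤ, DependsOn F (Λ : Set ℤ) := by
  obtain ⟨Λ, φ, -, rfl⟩ := hF
  exact ⟨Λ, fun ω ω' h => congrArg φ (funext fun k => h k k.2)⟩

lemma contDiff_comp_of_isSmoothLocal (hF : IsSmoothLocal F) {E : Type*} [NormedAddCommGroup E]
    [NormedSpace ℝ E] {c : E → Config} (hc : ∀ k, ContDiff ℝ (⊤ : ℕ∞) fun x => c x k) :
    ContDiff ℝ (⊤ : ℕ∞) fun x => F (c x) := by
  obtain ⟨Λ, φ, hφ, rfl⟩ := hF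
  exact hφ.comp (contDiff_pi.2 fun k => hc k)

lemma contDiff_update (hF : IsSmoothLocal F) (i : ℤ) (ω : Config) :
    ContDiff ℝ (⊤ : ℕ∞) fun x => F (Function.update ω i x) :=
  contDiff_comp_of_isSmoothLocal hF fun k => by
    rcases eq_or_ne k i with rfl | hk
    · simpa only [Function.update_self] using contDiff_fun_id
    · simpa only [Function.update_of_ne hk] using contDiff_const

lemma contDiff_resample (hF : IsSmoothLocal F) (i j : ℤ) (ω : Config) :
    ContDiff ℝ (⊤ : ℕ∞) fun x => F (resample i j ω x) :=
  contDiff_comp_of_isSmoothLocal hF fun k => by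
    unfold resample
    split_ifs <;> fun_prop

lemma isSmoothLocal_comp_site {f : ℝ × ℝ → ℝ} (hf : ContDiff ℝ (⊤ : ℕ∞) f) (i : ℤ) :
    IsSmoothLocal fun ω => f (ω i) :=
  ⟨{i}, fun x => f (x ⟨i, Finset.mem_singleton_self i⟩), hf.comp (contDiff_apply ℝ (ℝ × ℝ) _), rfl⟩

lemma isSmoothLocal_comp₂ (hF : IsSmoothLocal F) (hG : IsSmoothLocal G) {op : ℝ × ℝ → ℝ}
    (hop : ContDiff ℝ (⊤ : ℕ∞) op) : IsSmoothLocal fun ω => op (F ω, G ω) := by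
  classical
  have enlarge {Λ Λ' : Finset ℤ} (h : Λ ⊆ Λ') {φ : (Λ → ℝ × ℝ) → ℝ}
      (hφ : ContDiff ℝ (⊤ : ℕ∞) φ) :
      ContDiff ℝ (⊤ : ℕ∞) fun x : Λ' → ℝ × ℝ => φ fun k => x ⟨k, h k.2⟩ :=
    hφ.comp (contDiff_pi.2 fun k => contDiff_apply ℝ (ℝ × ℝ) (⟨k, h k.2⟩ : Λ'))
  obtain ⟨Λ, φ, hφ, rfl⟩ := hF
  obtain ⟨Λ', φ', hφ', rfl⟩ := hG
  exact ⟨Λ ∪ Λ', _, hop.comp ((enlarge Finset.subset_union_left hφ).prodMk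
    (enlarge Finset.subset_union_right hφ')), rfl⟩

/-- The algebra of smooth functions of finitely many coordinates. -/
def smoothLocal : Subalgebra ℝ (Config → ℝ) where
  carrier := {F | IsSmoothLocal F}
  mul_mem' hF hG := isSmoothLocal_comp₂ hF hG (contDiff_fst.mul contDiff_snd)
  add_mem' hF hG := isSmoothLocal_comp₂ hF hG (contDiff_fst.add contDiff_snd)
  algebraMap_mem' c := ⟨∅, fun _ => c, contDiff_const, rfl⟩

lemma isSmoothLocal_mom (i : ℤ) : IsSmoothLocal (mom i) := isSmoothLocal_comp_site contDiff_fst i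

lemma isSmoothLocal_comp_pos {f : ℝ → ℝ} (hf : ContDiff ℝ (⊤ : ℕ∞) f) (i : ℤ) :
    IsSmoothLocal fun ω => f (ω i).2 :=
  isSmoothLocal_comp_site (hf.comp contDiff_snd) i

lemma isSmoothLocal_shift (hF : IsSmoothLocal F) (j : ℤ) : IsSmoothLocal (shift j F) := by
  obtain ⟨Λ, φ, hφ, rfl⟩ := hF
  refine ⟨Λ.map (addRightEmbedding j), fun x => φ fun k => x ⟨k + j, ?_⟩, ?_, rfl⟩
  · simp
  · exact hφ.comp (contDiff_pi.2 fun k => contDiff_apply ℝ (ℝ × ℝ) _)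

/-- The derivative of `F` in the coordinates `(p_i, r_i)` of one site, in the direction `v`. -/
def siteDeriv (i : ℤ) (v : ℝ × ℝ) (F : Config → ℝ) : Config → ℝ := fun ω =>
  lineDeriv ℝ (fun x => F (Function.update ω i x)) (ω i) v

lemma dp_eq_siteDeriv (i : ℤ) (F : Config → ℝ) : dp i F = siteDeriv i (1, 0) F := by
  funext ω
  have h := deriv_comp_const_add (fun t => F (Function.update ω i (t, (ω i).2))) (ω i).1 0
  rw [add_zero] at h
  rw [dp, ← h]
  simp [siteDeriv, lineDeriv, Prod.add_def]

lemma dr_eq_siteDeriv (i : ℤ) (F : Config → ℝ) : dr i F = siteDeriv i (0, 1) F := by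
  funext ω
  have h := deriv_comp_const_add (fun t => F (Function.update ω i ((ω i).1, t))) (ω i).2 0
  rw [add_zero] at h
  rw [dr, ← h]
  simp [siteDeriv, lineDeriv, Prod.add_def]

lemma hasDerivAt_update_add_smul (hF : IsSmoothLocal F) (i : ℤ) (v : ℝ × ℝ) (ω : Config) :
    HasDerivAt (fun t : ℝ => F (Function.update ω i (ω i + t • v))) (siteDeriv i v F ω) 0 :=
  ((contDiff_update hF i ω).differentiable (by simp) _).lineDifferentiableAt.hasLineDerivAt

lemma siteDeriv_add (hF : IsSmoothLocal F) (hG : IsSmoothLocal G) (i : ℤ) (v : ℝ × ℝ) :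
    siteDeriv i v (F + G) = siteDeriv i v F + siteDeriv i v G :=
  funext fun ω =>
    ((hasDerivAt_update_add_smul hF i v ω).add (hasDerivAt_update_add_smul hG i v ω)).deriv

lemma siteDeriv_mul (hF : IsSmoothLocal F) (hG : IsSmoothLocal G) (i : ℤ) (v : ℝ × ℝ) :
    siteDeriv i v (F * G) = siteDeriv i v F * G + F * siteDeriv i v G := by
  funext ω
  have h := (hasDerivAt_update_add_smul hF i v ω).mul (hasDerivAt_update_add_smul hG i v ω)
  simp only [zero_smul, add_zero, Function.update_eq_self] at h
  exact h.deriv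

lemma siteDeriv_algebraMap (c : ℝ) (i : ℤ) (v : ℝ × ℝ) :
    siteDeriv i v (algebraMap ℝ (Config → ℝ) c) = 0 :=
  funext fun _ => deriv_const 0 c

lemma siteDeriv_mom (k i : ℤ) (v : ℝ × ℝ) :
    siteDeriv i v (mom k) = fun _ => if k = i then v.1 else 0 := by
  funext ω
  split_ifs with hk
  · subst hk
    simp [siteDeriv, mom, lineDeriv]
  · simp [siteDeriv, mom, Function.update_of_ne hk, lineDeriv]

lemma siteDeriv_comp_pos {f : ℝ → ℝ} (hf : Differentiable ℝ f) (k i : ℤ) (v : ℝ × ℝ) :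
    siteDeriv i v (fun ω => f (ω k).2) = fun ω => if k = i then deriv f (ω k).2 * v.2 else 0 := by
  funext ω
  split_ifs with hk
  · subst hk
    have hline : HasDerivAt (fun t : ℝ => (ω k).2 + t * v.2) v.2 0 := by
      simpa using ((hasDerivAt_id (0 : ℝ)).mul_const v.2).const_add (ω k).2
    have hf' := (hf ((ω k).2 + 0 * v.2)).hasDerivAt
    simpa [siteDeriv, lineDeriv, Function.comp_def] using (hf'.comp 0 hline).deriv
  · simp [siteDeriv, Function.update_of_ne hk, lineDeriv]

lemma siteDeriv_restrict {Λ : Finset ℤ} {φ : (Λ → ℝ × ℝ) → ℝ} (hφ : ContDiff ℝ (⊤ : ℕ∞) φ)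
    (i : ℤ) (v : ℝ × ℝ) :
    siteDeriv i v (fun ω => φ fun k => ω k) =
      fun ω => fderiv ℝ φ (fun k => ω k) fun k => if (k : ℤ) = i then v else 0 := by
  funext ω
  refine Eq.trans (congrArg (fun f => deriv f 0) (funext fun t => congrArg φ ?_))
    (hφ.differentiable (by simp) _).lineDeriv_eq_fderiv
  funext k
  by_cases hk : (k : ℤ) = i <;> simp [hk]

lemma contDiff_fderiv_apply_const {E : Type*} [NormedAddCommGroup E] [NormedSpace ℝ E]
    {φ : E → ℝ} (hφ : ContDiff ℝ (⊤ : ℕ∞) φ) (v : E) :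
    ContDiff ℝ (⊤ : ℕ∞) fun x => fderiv ℝ φ x v :=
  (hφ.fderiv_right (m := (⊤ : ℕ∞)) (by simp)).clm_apply contDiff_const

lemma isSmoothLocalCompact_siteDeriv (hF : IsSmoothLocalCompact F) (i : ℤ) (v : ℝ × ℝ) :
    IsSmoothLocalCompact (siteDeriv i v F) := by
  obtain ⟨Λ, φ, hφ, hc, rfl⟩ := hF
  exact ⟨Λ, _, contDiff_fderiv_apply_const hφ _, hc.fderiv_apply ℝ _, siteDeriv_restrict hφ i v⟩

/-! ### Shifts -/

lemma shift_update (F : Config → ℝ) (i j : ℤ) (ω : Config) (x : ℝ × ℝ) :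
    shift j F (Function.update ω i x) = F (Function.update (fun k => ω (k + j)) (i - j) x) := by
  refine congrArg F (funext fun k => ?_)
  simp only [Function.update_apply, eq_sub_iff_add_eq]

lemma siteDeriv_shift (F : Config → ℝ) (i j : ℤ) (v : ℝ × ℝ) :
    siteDeriv i v (shift j F) = shift j (siteDeriv (i - j) v F) := by
  funext ω
  simp only [siteDeriv, shift_update]
  simp [shift, siteDeriv]

lemma shift_shift (F : Config → ℝ) (i j : ℤ) : shift i (shift j F) = shift (i + j) F := by
  funext ω
  simp only [shift, add_assoc, add_comm i j]

@[simp] lemma shift_zero (F : Config → ℝ) : shift 0 F = F := by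
  funext ω
  simp [shift]

/-! ### The vector fields -/

variable (M : EnergyChain)

lemma Y_eq (i j : ℤ) (F : Config → ℝ) :
    M.Y i j F = mom i * siteDeriv j (0, 1) F - M.force j * siteDeriv i (1, 0) F := by
  funext ω
  simp only [Y, dp_eq_siteDeriv, dr_eq_siteDeriv]
  rfl

lemma Y_shift (F : Config → ℝ) (i j k : ℤ) :
    M.Y i j (shift k F) = shift k (M.Y (i - k) (j - k) F) := by
  funext ω
  simp [Y_eq, siteDeriv_shift, shift, mom, force]

lemma Y_add (hF : IsSmoothLocal F) (hG : IsSmoothLocal G) (i j : ℤ) :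
    M.Y i j (F + G) = M.Y i j F + M.Y i j G := by
  simp only [Y_eq, siteDeriv_add hF hG]
  ring

lemma Y_mul (hF : IsSmoothLocal F) (hG : IsSmoothLocal G) (i j : ℤ) :
    M.Y i j (F * G) = M.Y i j F * G + F * M.Y i j G := by
  simp only [Y_eq, siteDeriv_mul hF hG]
  ring

lemma Y_algebraMap (c : ℝ) (i j : ℤ) : M.Y i j (algebraMap ℝ (Config → ℝ) c) = 0 := by
  simp only [Y_eq, siteDeriv_algebraMap, mul_zero, sub_zero]

lemma Y_smul (hF : IsSmoothLocal F) (c : ℝ) (i j : ℤ) : M.Y i j (c • F) = c • M.Y i j F := by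
  rw [Algebra.smul_def, Y_mul M (smoothLocal.algebraMap_mem c) hF, Y_algebraMap, zero_mul, zero_add,
    ← Algebra.smul_def]

lemma Y_sum {ι : Type*} (s : Finset ι) {f : ι → Config → ℝ} (hf : ∀ k ∈ s, IsSmoothLocal (f k))
    (i j : ℤ) : M.Y i j (∑ k ∈ s, f k) = ∑ k ∈ s, M.Y i j (f k) := by
  classical
  induction s using Finset.induction_on with
  | empty => simpa using M.Y_algebraMap 0 i j
  | insert a s ha ih =>
    have hs := fun k hk => hf k (Finset.mem_insert_of_mem hk)
    rw [Finset.sum_insert ha, Finset.sum_insert ha, ← ih hs]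
    exact M.Y_add (hf a (Finset.mem_insert_self a s)) (smoothLocal.sum_mem hs) i j

lemma Y_mom (i j k : ℤ) : M.Y i j (mom k) = if k = i then -M.force j else 0 := by
  funext ω
  split_ifs with hk <;> simp [Y_eq, siteDeriv_mom, hk]

lemma Y_comp_pos {f : ℝ → ℝ} (hf : Differentiable ℝ f) (i j k : ℤ) :
    M.Y i j (fun ω => f (ω k).2) = if k = j then mom i * fun ω => deriv f (ω j).2 else 0 := by
  funext ω
  split_ifs with hk <;> simp [Y_eq, siteDeriv_comp_pos hf, hk]

lemma Y_pos (i j k : ℤ) : M.Y i j (pos k) = if k = j then mom i else 0 := by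
  refine (M.Y_comp_pos differentiable_id i j k).trans ?_
  split_ifs
  · funext ω
    simp
  · rfl

lemma Y_resample (F : Config → ℝ) (i j : ℤ) (ω : Config) (x : ℝ × ℝ) :
    M.Y i j F (resample i j ω x) = M.flowDeriv (fun x => F (resample i j ω x)) x := by
  have hpos (t : ℝ) : Function.update (resample i j ω x) j ((resample i j ω x j).1, t) =
      resample i j ω (x.1, t) := by
    funext k
    simp only [resample, Function.update_apply]
    grind
  have hmom (t : ℝ) : Function.update (resample i j ω x) i (t, (resample i j ω x i).2) =
      resample i j ω (t, x.2) := by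
    funext k
    simp only [resample, Function.update_apply]
    grind
  simp only [Y, flowDeriv, dp, dr, hpos, hmom]
  simp [resample]

lemma Y_eq_zero {Λ : Set ℤ} (hF : DependsOn F Λ) {i j : ℤ} (hi : i ∉ Λ) (hj : j ∉ Λ) :
    M.Y i j F = 0 := by
  have hconst (k : ℤ) (hk : k ∉ Λ) (v : ℝ × ℝ) : siteDeriv k v F = 0 := by
    funext ω
    have hupdate (x : ℝ × ℝ) : F (Function.update ω k x) = F ω :=
      hF fun l hl => Function.update_of_ne (ne_of_mem_of_not_mem hl hk) _ _
    simp [siteDeriv, hupdate, lineDeriv]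
  rw [Y_eq, hconst i hi, hconst j hj, mul_zero, mul_zero, sub_zero]

end EnergyChain

namespace EnergyChain

/-! ### Tame functions -/

variable (M : EnergyChain)

lemma shift_mem_momentAlgebra {F : Config → ℝ} (hF : F ∈ momentAlgebra M.gibbs) (j : ℤ) :
    shift j F ∈ momentAlgebra M.gibbs := by
  rw [shift_eq_comp]
  exact comp_mem_momentAlgebra hF (M.measurePreserving_shift j)

/-- The algebra of smooth local functions which have, together with their first derivatives,
finite moments of all orders. -/
def tame : Subalgebra ℝ (Config → ℝ) where
  carrier := {F | IsSmoothLocal F ∧ F ∈ momentAlgebra M.gibbs ∧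
    ∀ i v, siteDeriv i v F ∈ momentAlgebra M.gibbs}
  mul_mem' {F G} hF hG := ⟨smoothLocal.mul_mem hF.1 hG.1, mul_mem hF.2.1 hG.2.1, fun i v => by
    rw [siteDeriv_mul hF.1 hG.1]
    exact add_mem (mul_mem (hF.2.2 i v) hG.2.1) (mul_mem hF.2.1 (hG.2.2 i v))⟩
  add_mem' {F G} hF hG := ⟨smoothLocal.add_mem hF.1 hG.1, add_mem hF.2.1 hG.2.1, fun i v => by
    rw [siteDeriv_add hF.1 hG.1]
    exact add_mem (hF.2.2 i v) (hG.2.2 i v)⟩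
  algebraMap_mem' c := ⟨smoothLocal.algebraMap_mem c, Subalgebra.algebraMap_mem _ c, fun i v => by
    rw [siteDeriv_algebraMap]
    exact zero_mem _⟩

variable {M} {F G : Config → ℝ}

lemma shift_mem_tame (hF : F ∈ M.tame) (j : ℤ) : shift j F ∈ M.tame :=
  ⟨isSmoothLocal_shift hF.1 j, M.shift_mem_momentAlgebra hF.2.1 j, fun i v => by
    rw [siteDeriv_shift]
    exact M.shift_mem_momentAlgebra (hF.2.2 _ v) j⟩

variable (M) in
lemma mom_mem_tame (i : ℤ) : mom i ∈ M.tame :=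
  ⟨isSmoothLocal_mom i, M.mom_mem_momentAlgebra i, fun k v => by
    rw [siteDeriv_mom]
    exact Subalgebra.algebraMap_mem _ _⟩

lemma comp_pos_mem_tame {f : ℝ → ℝ} (hf : ContDiff ℝ (⊤ : ℕ∞) f)
    (hmem : f ∈ momentAlgebra M.posMeasure) (hmem' : deriv f ∈ momentAlgebra M.posMeasure)
    (i : ℤ) : (fun ω => f (ω i).2) ∈ M.tame := by
  refine ⟨isSmoothLocal_comp_pos hf i, M.comp_pos_mem_momentAlgebra hmem i, fun k v => ?_⟩
  rw [siteDeriv_comp_pos (hf.differentiable (by simp))]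
  split_ifs
  · exact mul_mem (M.comp_pos_mem_momentAlgebra hmem' i) (Subalgebra.algebraMap_mem _ v.2)
  · exact zero_mem _

variable (M)

lemma pos_mem_tame (i : ℤ) : pos i ∈ M.tame :=
  comp_pos_mem_tame contDiff_id M.id_mem_momentAlgebra_posMeasure
    (by rw [deriv_id']; exact one_mem _) i

lemma force_mem_tame (i : ℤ) : M.force i ∈ M.tame :=
  comp_pos_mem_tame M.contDiff_deriv_V M.deriv_V_mem_momentAlgebra
    M.deriv_deriv_V_mem_momentAlgebra i

lemma energy_eq (i : ℤ) : M.energy i = (1 / 2 : ℝ) • mom i ^ 2 + fun ω => M.V (ω i).2 := by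
  funext ω
  simp [energy, mom]
  ring

lemma energy_mem_tame (i : ℤ) : M.energy i ∈ M.tame := by
  rw [energy_eq]
  exact add_mem (Subalgebra.smul_mem _ (pow_mem (M.mom_mem_tame i) 2) _)
    (comp_pos_mem_tame M.V_smooth M.V_mem_momentAlgebra M.deriv_V_mem_momentAlgebra i)

variable {M}

lemma memLp_of_mem_tame (hF : F ∈ M.tame) : MemLp F 2 M.gibbs :=
  memLp_two_of_mem_momentAlgebra hF.2.1

lemma integrable_of_mem_tame (hF : F ∈ M.tame) : Integrable F M.gibbs :=
  (memLp_of_mem_tame hF).integrable one_le_two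

lemma memLp_Y (hF : F ∈ M.tame) (i j : ℤ) : MemLp (M.Y i j F) 2 M.gibbs := by
  refine memLp_two_of_mem_momentAlgebra ?_
  rw [Y_eq]
  exact sub_mem (mul_mem (M.mom_mem_tame i).2.1 (hF.2.2 j _))
    (mul_mem (M.force_mem_tame j).2.1 (hF.2.2 i _))

lemma mem_smoothL2 (hF : F ∈ M.tame) : F ∈ M.smoothL2 :=
  ⟨hF.1, memLp_of_mem_tame hF, fun i => ⟨memLp_Y hF i i, memLp_Y hF i (i + 1)⟩⟩

lemma integrable_mul_Y (hF : F ∈ M.tame) (hG : G ∈ M.tame) (i j : ℤ) :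
    Integrable (fun ω => F ω * M.Y i j G ω) M.gibbs :=
  (memLp_of_mem_tame hF).integrable_mul (memLp_Y hG i j)

/-! ### Test functions -/

lemma mem_tame_of_isSmoothLocalCompact (hF : IsSmoothLocalCompact F) : F ∈ M.tame := by
  have hmem {G : Config → ℝ} (hG : IsSmoothLocalCompact G) : G ∈ momentAlgebra M.gibbs := by
    obtain ⟨Λ, φ, hφ, hc, rfl⟩ := hG
    obtain ⟨C, hC⟩ := hc.exists_bound_of_continuous hφ.continuous
    exact mem_momentAlgebra_of_bounded (hφ.continuous.measurable.comp (by fun_prop)) fun ω => hC _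
  have hsmooth : IsSmoothLocal F := by
    obtain ⟨Λ, φ, hφ, -, h⟩ := hF
    exact ⟨Λ, φ, hφ, h⟩
  exact ⟨hsmooth, hmem hF, fun i v => hmem (isSmoothLocalCompact_siteDeriv hF i v)⟩

lemma mem_tame_of_mem_testSpace (hF : F ∈ M.testSpace) : F ∈ M.tame := by
  have hle : M.testSpace ≤ Subalgebra.toSubmodule M.tame :=
    Submodule.span_le.2 fun G hG => mem_tame_of_isSmoothLocalCompact hG.1
  exact hle hF

lemma siteDeriv_mem_tame_of_mem_testSpace (hF : F ∈ M.testSpace) (i : ℤ) (v : ℝ × ℝ) :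
    siteDeriv i v F ∈ M.tame := by
  induction hF using Submodule.span_induction with
  | mem G hG => exact mem_tame_of_isSmoothLocalCompact (isSmoothLocalCompact_siteDeriv hG.1 i v)
  | zero =>
    have h := siteDeriv_algebraMap 0 i v
    rw [map_zero] at h
    rw [h]
    exact zero_mem _
  | add G H hG hH ihG ihH =>
    rw [siteDeriv_add (mem_tame_of_mem_testSpace hG).1 (mem_tame_of_mem_testSpace hH).1]
    exact add_mem ihG ihH
  | smul c G hG ih =>
    rw [Algebra.smul_def, siteDeriv_mul (smoothLocal.algebraMap_mem c)
      (mem_tame_of_mem_testSpace hG).1, siteDeriv_algebraMap, zero_mul, zero_add]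
    exact mul_mem (Subalgebra.algebraMap_mem _ c) ih

lemma Y_mem_tame_of_mem_testSpace (hF : F ∈ M.testSpace) (i j : ℤ) : M.Y i j F ∈ M.tame := by
  rw [Y_eq]
  exact sub_mem (mul_mem (M.mom_mem_tame i) (siteDeriv_mem_tame_of_mem_testSpace hF j _))
    (mul_mem (M.force_mem_tame j) (siteDeriv_mem_tame_of_mem_testSpace hF i _))

end EnergyChain

namespace EnergyChain

/-! ### Integration by parts -/

variable {M : EnergyChain} {F G : Config → ℝ}

lemma integral_Y (hF : F ∈ M.tame) (i j : ℤ) : ∫ ω, M.Y i j F ω ∂M.gibbs = 0 := by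
  have hint : Integrable (M.Y i j F) M.gibbs := (memLp_Y hF i j).integrable one_le_two
  rw [M.integral_resample i j hint]
  refine integral_eq_zero_of_ae ?_
  filter_upwards [(M.integrable_resample i j hint).prod_right_ae] with ω hω
  simp only [Y_resample] at hω ⊢
  exact M.integral_flowDeriv ((contDiff_resample hF.1 i j ω).of_le (by simp)) hω

lemma integral_mul_Y (hF : F ∈ M.tame) (hG : G ∈ M.tame) (i j : ℤ) :
    ∫ ω, F ω * M.Y i j G ω ∂M.gibbs = -∫ ω, M.Y i j F ω * G ω ∂M.gibbs := by
  have hYF : Integrable (fun ω => M.Y i j F ω * G ω) M.gibbs := by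
    simpa only [mul_comm] using integrable_mul_Y hG hF i j
  have h := integral_Y (mul_mem hF hG) i j
  rw [M.Y_mul hF.1 hG.1] at h
  have hadd := integral_add hYF (integrable_mul_Y hF hG i j)
  exact eq_neg_of_add_eq_zero_right (hadd.symm.trans h)

lemma integral_self_mul_Y (hF : F ∈ M.tame) (i j : ℤ) :
    ∫ ω, F ω * M.Y i j F ω ∂M.gibbs = 0 := by
  have h := integral_mul_Y hF hF i j
  simp only [mul_comm (M.Y i j F _)] at h
  exact self_eq_neg.1 h

variable (M) in
lemma exists_sector : ∃ C : ℝ, 0 ≤ C ∧ ∀ F ∈ M.tame, ∀ G ∈ M.tame, ∀ i j : ℤ,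
    |∫ ω, F ω * M.Y i j G ω ∂M.gibbs| ≤
      C * ((∫ ω, M.Y i j F ω ^ 2 ∂M.gibbs) + ∫ ω, M.Y i j G ω ^ 2 ∂M.gibbs) := by
  obtain ⟨C, hC, hsite⟩ := M.exists_sector_site
  refine ⟨C, hC, fun F hF G hG i j => ?_⟩
  have hFG := integrable_mul_Y hF hG i j
  have hFF := (memLp_Y hF i j).integrable_sq
  have hGG := (memLp_Y hG i j).integrable_sq
  have rFG := M.integrable_resample i j hFG
  have rFF := M.integrable_resample i j hFF
  have rGG := M.integrable_resample i j hGG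
  rw [M.integral_resample i j hFG, M.integral_resample i j hFF, M.integral_resample i j hGG,
    ← integral_add rFF.integral_prod_left rGG.integral_prod_left, ← integral_const_mul]
  refine abs_integral_le_integral_abs.trans (integral_mono_ae rFG.integral_prod_left.abs
    ((rFF.integral_prod_left.add rGG.integral_prod_left).const_mul C) ?_)
  filter_upwards [rFG.prod_right_ae, rFF.prod_right_ae, rGG.prod_right_ae] with ω kFG kFF kGG
  simp only [Y_resample] at kFG kFF kGG ⊢
  exact hsite _ _ ((contDiff_resample hF.1 i j ω).of_le (by simp))
    ((contDiff_resample hG.1 i j ω).of_le (by simp)) kFG kFF kGG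

/-! ### Moments -/

variable (M)

lemma measurePreserving_mom_pos (i j : ℤ) :
    MeasurePreserving (fun ω : Config => ((ω i).1, (ω j).2)) M.gibbs M.siteMeasure := by
  refine measurePreserving_of_comp (M.measurePreserving_resample i j) (by fun_prop) ?_
  convert measurePreserving_snd (μ := M.gibbs) (ν := M.siteMeasure) using 1
  funext y
  simp [resample]

lemma integral_mom_mul_pos {f g : ℝ → ℝ} (hf : Continuous f) (hg : Continuous g) (i j : ℤ) :
    ∫ ω, f (ω i).1 * g (ω j).2 ∂M.gibbs = (∫ p, f p ∂M.momMeasure) * ∫ r, g r ∂M.posMeasure := by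
  have h := M.measurePreserving_mom_pos i j
  rw [← integral_prod_mul, ← siteMeasure_eq_prod, ← h.map_eq,
    integral_map h.measurable.aemeasurable]
  exact (by fun_prop : Continuous fun z : ℝ × ℝ => f z.1 * g z.2).aestronglyMeasurable

lemma integral_sq_momMeasure : ∫ p, p ^ 2 ∂M.momMeasure = M.β⁻¹ := by
  have h := ProbabilityTheory.variance_fun_id_gaussianReal (μ := 0) (v := M.β⁻¹.toNNReal)
  rwa [ProbabilityTheory.variance_of_integral_eq_zero (by fun_prop) (by simp),
    Real.coe_toNNReal _ (inv_pos.2 M.β_pos).le] at h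

lemma Y_mom_mul_pos (i j : ℤ) : M.Y i j (mom i * pos j) = mom i ^ 2 - M.force j * pos j := by
  rw [M.Y_mul (M.mom_mem_tame i).1 (M.pos_mem_tame j).1, Y_mom, Y_pos, if_pos rfl, if_pos rfl]
  ring

lemma integral_deriv_V_mul_id : ∫ r, deriv M.V r * r ∂M.posMeasure = M.β⁻¹ := by
  have hc := M.differentiable_deriv_V.continuous
  have hmom := M.integral_mom_mul_pos (f := fun p => p ^ 2) (g := fun _ => 1) (by fun_prop)
    (by fun_prop) 0 0
  have hpos := M.integral_mom_mul_pos (f := fun _ => 1) (g := fun r => deriv M.V r * r)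
    (by fun_prop) (by fun_prop) 0 0
  simp only [mul_one, one_mul, integral_const, probReal_univ, smul_eq_mul,
    integral_sq_momMeasure] at hmom hpos
  have h := integral_Y (mul_mem (M.mom_mem_tame 0) (M.pos_mem_tame 0)) 0 0
  rw [Y_mom_mul_pos] at h
  have hsub : (∫ ω : Config, (ω 0).1 ^ 2 ∂M.gibbs) -
      ∫ ω : Config, deriv M.V (ω 0).2 * (ω 0).2 ∂M.gibbs = 0 :=
    (integral_sub (integrable_of_mem_tame (pow_mem (M.mom_mem_tame 0) 2))
      (integrable_of_mem_tame (mul_mem (M.force_mem_tame 0) (M.pos_mem_tame 0)))).symm.trans h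
  rw [hmom, hpos] at hsub
  exact (sub_eq_zero.1 hsub).symm

lemma integral_mom_pos_mul_mom_force (j : ℤ) :
    ∫ ω, (mom 0 * pos j) ω * (mom 0 * M.force j) ω ∂M.gibbs = M.β⁻¹ ^ 2 := by
  have hc := M.differentiable_deriv_V.continuous
  have h := M.integral_mom_mul_pos (f := fun p => p ^ 2) (g := fun r => deriv M.V r * r)
    (by fun_prop) (by fun_prop) 0 j
  rw [integral_sq_momMeasure, integral_deriv_V_mul_id, ← sq] at h
  rw [← h]
  refine integral_congr_ae (Eventually.of_forall fun ω => ?_)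
  simp only [Pi.mul_apply, mom, pos, force]
  ring

lemma integral_mom_mul_pos_sq (j : ℤ) :
    ∫ ω, (mom 0 * pos j) ω ^ 2 ∂M.gibbs = M.β⁻¹ * ∫ ω, (ω 0).2 ^ 2 ∂M.gibbs := by
  have hprod := M.integral_mom_mul_pos (f := fun p => p ^ 2) (g := fun r => r ^ 2)
    (by fun_prop) (by fun_prop) 0 j
  have hpos := M.integral_mom_mul_pos (f := fun _ => 1) (g := fun r => r ^ 2)
    (by fun_prop) (by fun_prop) 0 0
  simp only [one_mul, integral_const, probReal_univ, smul_eq_mul] at hpos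
  rw [hpos, ← M.integral_sq_momMeasure, ← hprod]
  simp only [Pi.mul_apply, mom, pos, mul_pow]

end EnergyChain

namespace EnergyChain

/-! ### The formal sums `Γ_F` -/

/-- `Y_{0,s} Γ_F`; the paper's `X_0 Γ_F` and `Y_{0,1} Γ_F` are the cases `s = 0` and `s = 1`. -/
def gammaDeriv (M : EnergyChain) (s : ℤ) (F : Config → ℝ) : Config → ℝ := fun ω =>
  ∑ᶠ k : ℤ, M.Y 0 s (shift k F) ω

/-- `J` contains all `k` for which `τ_k F` has a nonzero derivative along `Y_{0,s}`. -/
def IsWindow (M : EnergyChain) (s : ℤ) (F : Config → ℝ) (J : Finset ℤ) : Prop :=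
  ∀ k ∉ J, M.Y 0 s (shift k F) = 0

/-- The finite part `∑_{k ∈ J} τ_k F` of `Γ_F`. -/
def partialGamma (J : Finset ℤ) (F : Config → ℝ) : Config → ℝ := ∑ k ∈ J, shift k F

variable {M : EnergyChain} {F G : Config → ℝ} {J J' : Finset ℤ} {s : ℤ}

lemma IsWindow.mono (h : M.IsWindow s F J) (hJ : J ⊆ J') : M.IsWindow s F J' :=
  fun k hk => h k fun hkJ => hk (hJ hkJ)

lemma dependsOn_shift {Λ : Set ℤ} (hF : DependsOn F Λ) (k : ℤ) :
    DependsOn (shift k F) {i | i - k ∈ Λ} := fun ω ω' h =>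
  hF fun l hl => h (l + k) (by simpa using hl)

lemma exists_isWindow (M : EnergyChain) (hF : IsSmoothLocal F) (s : ℤ) :
    ∃ J, M.IsWindow s F J := by
  classical
  obtain ⟨Λ, hΛ⟩ := exists_dependsOn hF
  refine ⟨Λ.image (fun l => -l) ∪ Λ.image (fun l => s - l), fun k hk => ?_⟩
  simp only [Finset.mem_union, Finset.mem_image, not_or, not_exists, not_and] at hk
  exact M.Y_eq_zero (dependsOn_shift hΛ k) (fun h => hk.1 _ h (by ring))
    fun h => hk.2 _ h (by ring)

lemma partialGamma_mem_tame (hF : F ∈ M.tame) (J : Finset ℤ) : partialGamma J F ∈ M.tame :=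
  sum_mem fun k _ => shift_mem_tame hF k

lemma Y_partialGamma (M : EnergyChain) (hF : IsSmoothLocal F) (J : Finset ℤ) (i j : ℤ) :
    M.Y i j (partialGamma J F) = ∑ k ∈ J, M.Y i j (shift k F) :=
  M.Y_sum J (fun k _ => isSmoothLocal_shift hF k) i j

lemma gammaDeriv_eq_sum (h : M.IsWindow s F J) :
    M.gammaDeriv s F = ∑ k ∈ J, M.Y 0 s (shift k F) := by
  funext ω
  rw [gammaDeriv, Finset.sum_apply]
  refine finsum_eq_sum_of_support_subset _ fun k hk => ?_
  by_contra hkJ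
  exact hk (congrFun (h k hkJ) ω)

lemma gammaDeriv_eq_Y_partialGamma (hF : IsSmoothLocal F) (h : M.IsWindow s F J) :
    M.gammaDeriv s F = M.Y 0 s (partialGamma J F) := by
  rw [M.Y_partialGamma hF, gammaDeriv_eq_sum h]

lemma memLp_gammaDeriv (hF : F ∈ M.tame) (s : ℤ) : MemLp (M.gammaDeriv s F) 2 M.gibbs := by
  obtain ⟨J, hJ⟩ := M.exists_isWindow hF.1 s
  rw [gammaDeriv_eq_Y_partialGamma hF.1 hJ]
  exact memLp_Y (partialGamma_mem_tame hF J) 0 s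

lemma gammaDeriv_zero (M : EnergyChain) (s : ℤ) : M.gammaDeriv s 0 = 0 := by
  funext ω
  simp [gammaDeriv, shift, Y, dp, dr]

lemma gammaDeriv_add (M : EnergyChain) (hF : IsSmoothLocal F) (hG : IsSmoothLocal G) (s : ℤ) :
    M.gammaDeriv s (F + G) = M.gammaDeriv s F + M.gammaDeriv s G := by
  classical
  obtain ⟨J, hJ⟩ := M.exists_isWindow hF s
  obtain ⟨J', hJ'⟩ := M.exists_isWindow hG s
  have hY (k : ℤ) : M.Y 0 s (shift k (F + G)) = M.Y 0 s (shift k F) + M.Y 0 s (shift k G) :=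
    M.Y_add (isSmoothLocal_shift hF k) (isSmoothLocal_shift hG k) 0 s
  have hJF := hJ.mono (J' := J ∪ J') Finset.subset_union_left
  have hJG := hJ'.mono (J' := J ∪ J') Finset.subset_union_right
  have hFG : M.IsWindow s (F + G) (J ∪ J') := fun k hk => by
    rw [hY, hJF k hk, hJG k hk, add_zero]
  rw [gammaDeriv_eq_sum hFG, gammaDeriv_eq_sum hJF, gammaDeriv_eq_sum hJG,
    ← Finset.sum_add_distrib]
  exact Finset.sum_congr rfl fun k _ => hY k

lemma gammaDeriv_smul (M : EnergyChain) (hF : IsSmoothLocal F) (c : ℝ) (s : ℤ) :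
    M.gammaDeriv s (c • F) = c • M.gammaDeriv s F := by
  funext ω
  have hY (k : ℤ) : M.Y 0 s (shift k (c • F)) = c • M.Y 0 s (shift k F) :=
    M.Y_smul (isSmoothLocal_shift hF k) c 0 s
  simp only [gammaDeriv, hY, Pi.smul_apply, smul_finsum]

/-! ### The formal sums `Γ_g + a ∑ k ℰ_k` -/

/-- The `k`-th term of the formal sum `Γ_g + a ∑_k k ℰ_k`, the trial functions in the variational
formula for the seminorm. -/
def trialTerm (M : EnergyChain) (g : Config → ℝ) (a : ℝ) (k : ℤ) : Config → ℝ :=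
  shift k g + (a * k) • M.energy k

/-- `Y_{0,s} (Γ_g + a ∑_k k ℰ_k)`, where `Y_{0,s} ∑_k k ℰ_k = s p_0 V'(r_s)`. -/
def trialDeriv (M : EnergyChain) (s : ℤ) (g : Config → ℝ) (a : ℝ) : Config → ℝ :=
  M.gammaDeriv s g + (a * s) • (mom 0 * M.force s)

lemma trialTerm_mem_tame (hF : F ∈ M.tame) (a : ℝ) (k : ℤ) : M.trialTerm F a k ∈ M.tame :=
  add_mem (shift_mem_tame hF k) (Subalgebra.smul_mem _ (M.energy_mem_tame k) _)

lemma memLp_trialDeriv (hF : F ∈ M.tame) (s : ℤ) (a : ℝ) :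
    MemLp (M.trialDeriv s F a) 2 M.gibbs :=
  (memLp_gammaDeriv hF s).add
    ((memLp_of_mem_tame (mul_mem (M.mom_mem_tame 0) (M.force_mem_tame s))).const_smul _)

lemma Y_energy (M : EnergyChain) (i j k : ℤ) : M.Y i j (M.energy k) =
    ((if k = j then 1 else 0) - if k = i then 1 else 0 : ℝ) • (mom i * M.force j) := by
  have hmom := isSmoothLocal_mom k
  have hsq := smoothLocal.mul_mem hmom hmom
  rw [energy_eq, sq, M.Y_add (smoothLocal.smul_mem hsq _) (isSmoothLocal_comp_pos M.V_smooth k),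
    M.Y_smul hsq, M.Y_mul hmom hmom, Y_mom, M.Y_comp_pos M.differentiable_V]
  split_ifs with hi hj hj <;> funext ω <;> simp [force, hi] <;> ring

lemma sum_smul_Y_energy (M : EnergyChain) (a : ℝ) {i j : ℤ} {K : Finset ℤ} (hi : i ∈ K)
    (hj : j ∈ K) :
    ∑ k ∈ K, (a * k) • M.Y i j (M.energy k) = (a * (j - i)) • (mom i * M.force j) := by
  simp only [Y_energy, smul_smul, ← Finset.sum_smul]
  congr 1
  simp only [mul_sub, mul_ite, mul_one, mul_zero, Finset.sum_sub_distrib, Finset.sum_ite_eq',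
    if_pos hi, if_pos hj]

lemma shift_add (i : ℤ) (F G : Config → ℝ) : shift i (F + G) = shift i F + shift i G := rfl

lemma shift_sum {ι : Type*} (i : ℤ) (K : Finset ι) (f : ι → Config → ℝ) :
    shift i (∑ k ∈ K, f k) = ∑ k ∈ K, shift i (f k) := by
  funext ω
  simp only [shift, Finset.sum_apply]

lemma Y_add_shift_add (M : EnergyChain) (F : Config → ℝ) (i s l : ℤ) :
    M.Y i (i + s) (shift (l + i) F) = shift i (M.Y 0 s (shift l F)) := by
  have hi : i - (l + i) = 0 - l := by ring
  have his : i + s - (l + i) = s - l := by ring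
  rw [Y_shift, Y_shift, shift_shift, hi, his, add_comm]

lemma Y_trialTerm (hF : F ∈ M.tame) (a : ℝ) (i j k : ℤ) :
    M.Y i j (M.trialTerm F a k) = M.Y i j (shift k F) + (a * k) • M.Y i j (M.energy k) := by
  have hE := (M.energy_mem_tame k).1
  rw [trialTerm, M.Y_add (isSmoothLocal_shift hF.1 k) (smoothLocal.smul_mem hE _), M.Y_smul hE]

lemma exists_sum_Y_trialTerm (hF : F ∈ M.tame) (a : ℝ) (i s : ℤ) :
    ∃ K : Finset ℤ, (∀ k ∉ K, M.Y i (i + s) (M.trialTerm F a k) = 0) ∧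
      ∑ k ∈ K, M.Y i (i + s) (M.trialTerm F a k) = shift i (M.trialDeriv s F a) := by
  classical
  obtain ⟨J, hJ⟩ := M.exists_isWindow hF.1 s
  set K : Finset ℤ := (J ∪ {0, s}).map (addRightEmbedding i) with hK
  have hmem (k : ℤ) : k ∈ K ↔ k - i ∈ J ∪ {0, s} := by
    simp only [hK, Finset.mem_map, addRightEmbedding_apply, ← eq_sub_iff_add_eq, exists_eq_right]
  have hi : i ∈ K := by simp [hmem]
  have his : i + s ∈ K := by simp [hmem]
  refine ⟨K, fun k hk => ?_, ?_⟩
  · have hki : k ≠ i := fun h => hk (h ▸ hi)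
    have hkis : k ≠ i + s := fun h => hk (h ▸ his)
    have hshift := M.Y_add_shift_add F i s (k - i)
    rw [hJ (k - i) fun h => hk ((hmem k).2 (Finset.mem_union_left _ h)), sub_add_cancel] at hshift
    rw [Y_trialTerm hF, hshift, Y_energy, if_neg hki, if_neg hkis, sub_zero, zero_smul, smul_zero,
      add_zero]
    rfl
  · have hgamma : ∑ k ∈ K, M.Y i (i + s) (shift k F) = shift i (M.gammaDeriv s F) := by
      rw [gammaDeriv_eq_sum (hJ.mono (Finset.subset_union_left (s₂ := {0, s}))), shift_sum,
        Finset.sum_map]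
      exact Finset.sum_congr rfl fun l _ => M.Y_add_shift_add F i s l
    simp only [Y_trialTerm hF, Finset.sum_add_distrib, hgamma, M.sum_smul_Y_energy a hi his,
      trialDeriv, shift_add]
    funext ω
    simp [shift, mom, force, add_comm s i]

end EnergyChain

lemma integral_add_mul {Ω : Type*} [MeasurableSpace Ω] {μ : Measure Ω} {u u' w : Ω → ℝ}
    (hu : MemLp u 2 μ) (hu' : MemLp u' 2 μ) (hw : MemLp w 2 μ) :
    ∫ ω, (u + u') ω * w ω ∂μ = (∫ ω, u ω * w ω ∂μ) + ∫ ω, u' ω * w ω ∂μ := by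
  simp only [Pi.add_apply, add_mul]
  exact integral_add (hu.integrable_mul hw) (hu'.integrable_mul hw)

lemma integral_smul_mul {Ω : Type*} [MeasurableSpace Ω] {μ : Measure Ω} (c : ℝ) (u w : Ω → ℝ) :
    ∫ ω, (c • u) ω * w ω ∂μ = c * ∫ ω, u ω * w ω ∂μ := by
  simp only [Pi.smul_apply, smul_eq_mul, mul_assoc, integral_const_mul]

namespace EnergyChain

/-! ### Representation of fluctuations -/

/-- The triples `(h, u, v)` for which the linear functional `(g, a) ↦ ≪g, h≫_* + a ≪h≫_**`
is `-⟨u, Y_{0,1}Γ_g + a p_0 V'(r_1)⟩ - ⟨v, X_0 Γ_g⟩`. The left-hand side is encoded as the sum over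
`k` of the averages of `h` against the `k`-th term of `Γ_g + a ∑_k k ℰ_k`. -/
def repSpace (M : EnergyChain) :
    Submodule ℝ ((Config → ℝ) × (Config → ℝ) × (Config → ℝ)) where
  carrier := {x | (MemLp x.1 2 M.gibbs ∧ MemLp x.2.1 2 M.gibbs ∧ MemLp x.2.2 2 M.gibbs) ∧
    ∀ g ∈ M.testSpace, ∀ a : ℝ,
      (Function.support fun k : ℤ => ∫ ω, x.1 ω * M.trialTerm g a k ω ∂M.gibbs).Finite ∧
      ∑ᶠ k : ℤ, ∫ ω, x.1 ω * M.trialTerm g a k ω ∂M.gibbs =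
        -(∫ ω, x.2.1 ω * M.trialDeriv 1 g a ω ∂M.gibbs) -
          ∫ ω, x.2.2 ω * M.trialDeriv 0 g a ω ∂M.gibbs}
  zero_mem' := ⟨⟨MemLp.zero, MemLp.zero, MemLp.zero⟩, fun g _ a => by simp⟩
  add_mem' {x y} hx hy := by
    obtain ⟨⟨hx₁, hx₂, hx₃⟩, hx⟩ := hx
    obtain ⟨⟨hy₁, hy₂, hy₃⟩, hy⟩ := hy
    refine ⟨⟨hx₁.add hy₁, hx₂.add hy₂, hx₃.add hy₃⟩, fun g hg a => ?_⟩
    have hg' := mem_tame_of_mem_testSpace hg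
    have hterm (k : ℤ) := integral_add_mul hx₁ hy₁ (memLp_of_mem_tame (trialTerm_mem_tame hg' a k))
    obtain ⟨hx_fin, hx_eq⟩ := hx g hg a
    obtain ⟨hy_fin, hy_eq⟩ := hy g hg a
    simp only [Prod.fst_add, Prod.snd_add, hterm]
    refine ⟨(hx_fin.union hy_fin).subset (Function.support_add _ _), ?_⟩
    rw [finsum_add_distrib hx_fin hy_fin, hx_eq, hy_eq,
      integral_add_mul hx₂ hy₂ (memLp_trialDeriv hg' 1 a),
      integral_add_mul hx₃ hy₃ (memLp_trialDeriv hg' 0 a)]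
    ring
  smul_mem' c x hx := by
    obtain ⟨⟨hx₁, hx₂, hx₃⟩, hx⟩ := hx
    refine ⟨⟨hx₁.const_smul c, hx₂.const_smul c, hx₃.const_smul c⟩, fun g hg a => ?_⟩
    obtain ⟨hx_fin, hx_eq⟩ := hx g hg a
    simp only [Prod.smul_fst, Prod.smul_snd, integral_smul_mul]
    refine ⟨hx_fin.subset (Function.support_const_smul_subset c _), ?_⟩
    rw [← mul_finsum, hx_eq]
    ring

variable {M : EnergyChain} {F g h u v : Config → ℝ}

lemma finsum_integral_Y_mul_trialTerm (hF : F ∈ M.tame) (hg : g ∈ M.tame) (a : ℝ) (i s : ℤ) :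
    (Function.support fun k : ℤ =>
      ∫ ω, M.Y i (i + s) F ω * M.trialTerm g a k ω ∂M.gibbs).Finite ∧
    ∑ᶠ k : ℤ, ∫ ω, M.Y i (i + s) F ω * M.trialTerm g a k ω ∂M.gibbs =
      -∫ ω, shift (-i) F ω * M.trialDeriv s g a ω ∂M.gibbs := by
  obtain ⟨K, hK, hsum⟩ := exists_sum_Y_trialTerm hg a i s
  have hparts (k : ℤ) : ∫ ω, M.Y i (i + s) F ω * M.trialTerm g a k ω ∂M.gibbs =
      -∫ ω, F ω * M.Y i (i + s) (M.trialTerm g a k) ω ∂M.gibbs := by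
    rw [integral_mul_Y hF (trialTerm_mem_tame hg a k), neg_neg]
  have hsupp : (Function.support fun k : ℤ =>
      -∫ ω, F ω * M.Y i (i + s) (M.trialTerm g a k) ω ∂M.gibbs) ⊆ K := fun k hk => by
    by_contra hkK
    exact hk (by simp [hK k hkK])
  simp only [hparts]
  refine ⟨K.finite_toSet.subset hsupp, ?_⟩
  rw [finsum_eq_sum_of_support_subset _ hsupp, Finset.sum_neg_distrib,
    ← integral_finsetSum _ fun k _ => integrable_mul_Y hF (trialTerm_mem_tame hg a k) _ _]
  simp only [← Finset.mul_sum, ← Finset.sum_apply, hsum]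
  rw [← M.integral_shift (-i)]
  simp only [shift, add_neg_cancel_right]

lemma X_mem_repSpace (hF : F ∈ M.tame) (i : ℤ) : (M.X i F, 0, shift (-i) F) ∈ M.repSpace := by
  refine ⟨⟨memLp_Y hF i i, MemLp.zero, memLp_of_mem_tame (shift_mem_tame hF _)⟩, fun g hg a => ?_⟩
  have h := finsum_integral_Y_mul_trialTerm hF (mem_tame_of_mem_testSpace hg) a i 0
  rw [add_zero] at h
  exact ⟨h.1, h.2.trans (by simp)⟩

lemma Y_mem_repSpace (hF : F ∈ M.tame) (i : ℤ) :
    (M.Y i (i + 1) F, shift (-i) F, 0) ∈ M.repSpace := by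
  refine ⟨⟨memLp_Y hF i _, memLp_of_mem_tame (shift_mem_tame hF _), MemLp.zero⟩, fun g hg a => ?_⟩
  have h := finsum_integral_Y_mul_trialTerm hF (mem_tame_of_mem_testSpace hg) a i 1
  exact ⟨h.1, h.2.trans (by simp)⟩

lemma starForm_eq_finsum (M : EnergyChain) (g h : Config → ℝ) :
    M.starForm g h = ∑ᶠ k : ℤ, ∫ ω, h ω * M.trialTerm g 0 k ω ∂M.gibbs := by
  rw [starForm, ← finsum_comp_equiv (Equiv.neg ℤ)]
  refine finsum_congr fun k => ?_
  rw [← M.integral_shift k]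
  simp [shift, trialTerm, mul_comm]

lemma mul_starStarForm_eq_finsum (M : EnergyChain) (a : ℝ) (h : Config → ℝ) :
    a * M.starStarForm h = ∑ᶠ k : ℤ, ∫ ω, h ω * M.trialTerm 0 a k ω ∂M.gibbs := by
  rw [starStarForm, mul_finsum]
  refine finsum_congr fun k => ?_
  rw [← mul_assoc, ← integral_const_mul]
  refine integral_congr_ae (Eventually.of_forall fun ω => ?_)
  simp only [trialTerm, shift, Pi.add_apply, Pi.zero_apply, Pi.smul_apply, smul_eq_mul, zero_add]
  ring

lemma trialDeriv_eq_add (M : EnergyChain) (s : ℤ) (g : Config → ℝ) (a : ℝ) :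
    M.trialDeriv s g a = M.trialDeriv s g 0 + M.trialDeriv s 0 a := by
  simp only [trialDeriv, gammaDeriv_zero, zero_mul, zero_smul, add_zero, zero_add]

lemma starForm_add_starStarForm (hx : (h, u, v) ∈ M.repSpace) (hg : g ∈ M.testSpace) (a : ℝ) :
    M.starForm g h + a * M.starStarForm h =
      -(∫ ω, u ω * M.trialDeriv 1 g a ω ∂M.gibbs) - ∫ ω, v ω * M.trialDeriv 0 g a ω ∂M.gibbs := by
  obtain ⟨⟨-, hu, hv⟩, hx⟩ := hx
  have hD {f : Config → ℝ} (hf : f ∈ M.testSpace) (s : ℤ) (b : ℝ) :=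
    memLp_trialDeriv (mem_tame_of_mem_testSpace hf) s b
  have hsplit {w : Config → ℝ} (hw : MemLp w 2 M.gibbs) (s : ℤ) :
      ∫ ω, w ω * M.trialDeriv s g a ω ∂M.gibbs = (∫ ω, w ω * M.trialDeriv s g 0 ω ∂M.gibbs) +
        ∫ ω, w ω * M.trialDeriv s 0 a ω ∂M.gibbs := by
    rw [trialDeriv_eq_add]
    simp only [mul_comm (w _)]
    exact integral_add_mul (hD hg s 0) (hD (zero_mem _) s a) hw
  rw [starForm_eq_finsum, mul_starStarForm_eq_finsum, (hx g hg 0).2, (hx 0 (zero_mem _) a).2,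
    hsplit hu, hsplit hv]
  ring

end EnergyChain

namespace EnergyChain

/-! ### Current, gradient and generator -/

variable {M : EnergyChain} {F g : Config → ℝ}

variable (M) in
lemma Y_mom_mul_force : M.Y 0 1 (mom 0 * M.force 1) =
    mom 0 ^ 2 * (fun ω => deriv (deriv M.V) (ω 1).2) - M.force 1 ^ 2 := by
  rw [M.Y_mul (M.mom_mem_tame 0).1 (M.force_mem_tame 1).1, Y_mom, if_pos rfl]
  unfold force
  rw [M.Y_comp_pos M.differentiable_deriv_V, if_pos rfl]
  ring

variable (M) in
lemma Y_energy_one : M.Y 0 1 (M.energy 1) = mom 0 * M.force 1 := by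
  simp [Y_energy]

variable (M) in
lemma X_energy_one : M.X 0 (M.energy 1) = 0 := by
  simp [X, Y_energy]

variable (M) in
lemma current_eq : M.current = M.Y 0 1 ((M.γ / 2) • (mom 0 * M.force 1) - M.energy 1) := by
  have hmf := mul_mem (M.mom_mem_tame 0) (M.force_mem_tame 1)
  rw [sub_eq_add_neg, ← neg_one_smul ℝ (M.energy 1),
    M.Y_add (smoothLocal.smul_mem hmf.1 _) (smoothLocal.smul_mem (M.energy_mem_tame 1).1 _),
    M.Y_smul hmf.1, M.Y_smul (M.energy_mem_tame 1).1, Y_mom_mul_force, Y_energy_one]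
  funext ω
  simp only [current, mom, force, Pi.add_apply, Pi.smul_apply, Pi.sub_apply, Pi.mul_apply,
    Pi.pow_apply, smul_eq_mul]
  ring

variable (M) in
lemma gradient_eq : gradient = M.X 1 (mom 1 * pos 1) + M.Y 0 1 (-(mom 0 * pos 1)) := by
  rw [X, Y_mom_mul_pos, ← neg_one_smul ℝ (mom 0 * pos 1),
    M.Y_smul (mul_mem (M.mom_mem_tame 0) (M.pos_mem_tame 1)).1, Y_mom_mul_pos]
  funext ω
  simp only [gradient, mom, Pi.add_apply, Pi.smul_apply, Pi.sub_apply, Pi.mul_apply,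
    Pi.pow_apply, smul_eq_mul]
  ring

lemma X_add_Y_mem_fluctSpace (hF : F ∈ M.tame) (hg : g ∈ M.tame) {i j : ℤ} (hij : i ≠ j) :
    M.X i F + M.Y j (j + 1) g ∈ M.fluctSpace := by
  have hsingle {f : Config → ℝ} (hf : f ∈ M.tame) (k l : ℤ) :
      (Pi.single k f : ℤ → Config → ℝ) l ∈ M.smoothL2 := by
    refine mem_smoothL2 ?_
    rw [Pi.single_apply]
    split_ifs
    exacts [hf, zero_mem _]
  have hzero (k l : ℤ) : M.Y k l 0 = 0 := M.Y_algebraMap 0 k l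
  refine ⟨{i, j}, Pi.single i F, Pi.single j g, fun l _ => ⟨hsingle hF i l, hsingle hg j l⟩, ?_⟩
  simp [Finset.sum_pair hij, X, hij, hij.symm, hzero]

variable (M) in
lemma current_add_smul_gradient_mem_fluctSpace (κ : ℝ) :
    M.current + κ • gradient ∈ M.fluctSpace := by
  have hp (i : ℤ) := mul_mem (M.mom_mem_tame i) (M.pos_mem_tame 1)
  have hW : (M.γ / 2) • (mom 0 * M.force 1) - M.energy 1 ∈ M.tame :=
    sub_mem (Subalgebra.smul_mem _ (mul_mem (M.mom_mem_tame 0) (M.force_mem_tame 1)) _)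
      (M.energy_mem_tame 1)
  have hY : κ • -(mom 0 * pos 1) ∈ M.tame := Subalgebra.smul_mem _ (neg_mem (hp 0)) _
  have h := X_add_Y_mem_fluctSpace (Subalgebra.smul_mem _ (hp 1) κ) (add_mem hW hY) one_ne_zero
  rw [X, M.Y_smul (hp 1).1, M.Y_add hW.1 hY.1, M.Y_smul (neg_mem (hp 0)).1, zero_add,
    ← current_eq, add_left_comm, ← smul_add] at h
  rwa [M.gradient_eq]

variable (M) in
lemma current_mem_repSpace :
    (M.current, (M.γ / 2) • M.Y 0 1 (M.energy 1) - M.energy 1,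
      (M.γ / 2) • M.X 0 (M.energy 1) + M.energy 1) ∈ M.repSpace := by
  have hE := M.energy_mem_tame 1
  have hW := sub_mem (Subalgebra.smul_mem _ (mul_mem (M.mom_mem_tame 0) (M.force_mem_tame 1))
    (M.γ / 2)) hE
  have h := add_mem (Y_mem_repSpace hW 0) (X_mem_repSpace hE 0)
  simpa [← current_eq, Y_energy_one, X_energy_one] using h

variable (M) in
lemma gradient_mem_repSpace : (gradient, -(mom 0 * pos 1), mom 0 * pos 0) ∈ M.repSpace := by
  have hX := X_mem_repSpace (mul_mem (M.mom_mem_tame 1) (M.pos_mem_tame 1)) 1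
  have hY := Y_mem_repSpace (neg_mem (mul_mem (M.mom_mem_tame 0) (M.pos_mem_tame 1))) 0
  have hshift : shift (-1) (mom 1 * pos 1) = mom 0 * pos 0 := by
    funext ω
    simp [shift, mom, pos]
  have h := add_mem hX hY
  simpa [gradient_eq M, hshift] using h

lemma finsum_telescope {a : ℤ → ℝ} {c : ℝ} {Λ : Finset ℤ} (ha : ∀ k ∉ Λ, a k = c) :
    ∑ᶠ k : ℤ, (a (1 + k) - a k) = 0 := by
  have hfin : (Function.support fun k => a k - c).Finite := by
    refine Λ.finite_toSet.subset fun k hk => ?_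
    by_contra hkΛ
    exact hk (sub_eq_zero.2 (ha k hkΛ))
  have hfin' : (Function.support fun k => a (1 + k) - c).Finite :=
    hfin.preimage (Equiv.addLeft (1 : ℤ)).injective.injOn
  calc ∑ᶠ k : ℤ, (a (1 + k) - a k) = ∑ᶠ k : ℤ, ((a (1 + k) - c) - (a k - c)) := by
        simp only [sub_sub_sub_cancel_right]
    _ = (∑ᶠ k : ℤ, (a (1 + k) - c)) - ∑ᶠ k : ℤ, (a k - c) := finsum_sub_distrib hfin' hfin
    _ = 0 := sub_eq_zero.2 (finsum_comp_equiv (Equiv.addLeft (1 : ℤ)) (f := fun k => a k - c))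

lemma integral_mul_mom_sq {Λ : Set ℤ} (hg : g ∈ M.tame) (hΛ : DependsOn g Λ) {k : ℤ}
    (hk : k ∉ Λ) : ∫ ω, g ω * (ω k).1 ^ 2 ∂M.gibbs =
      (∫ ω, g ω ∂M.gibbs) * ∫ x, x.1 ^ 2 ∂M.siteMeasure := by
  have hint : Integrable (fun ω => g ω * (ω k).1 ^ 2) M.gibbs :=
    integrable_of_mem_tame (mul_mem hg (pow_mem (M.mom_mem_tame k) 2))
  rw [M.integral_resample k k hint, ← integral_mul_const]
  refine integral_congr_ae (Eventually.of_forall fun ω => ?_)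
  simp only [← integral_const_mul]
  refine integral_congr_ae (Eventually.of_forall fun x => ?_)
  have hresample : g (resample k k ω x) = g ω := hΛ fun l hl => by
    simp [resample, ne_of_mem_of_not_mem hl hk]
  simp [hresample, resample]

lemma starForm_gradient (hg : g ∈ M.tame) : M.starForm g gradient = 0 := by
  obtain ⟨Λ, hΛ⟩ := exists_dependsOn hg.1
  have hint (k : ℤ) : Integrable (fun ω => g ω * (ω k).1 ^ 2) M.gibbs :=
    integrable_of_mem_tame (mul_mem hg (pow_mem (M.mom_mem_tame k) 2))
  have hdiff (k : ℤ) : ∫ ω, g ω * shift k gradient ω ∂M.gibbs =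
      (∫ ω, g ω * (ω (1 + k)).1 ^ 2 ∂M.gibbs) - ∫ ω, g ω * (ω k).1 ^ 2 ∂M.gibbs := by
    rw [← integral_sub (hint _) (hint _)]
    simp only [shift, gradient, zero_add, mul_sub]
  simp only [starForm, hdiff]
  exact finsum_telescope fun k hk => integral_mul_mom_sq hg hΛ hk

lemma starStarForm_gradient (M : EnergyChain) : M.starStarForm gradient = M.β⁻¹ ^ 2 := by
  have h := starForm_add_starStarForm M.gradient_mem_repSpace (zero_mem _) 1
  rw [starForm_gradient (zero_mem _)] at h
  simpa [trialDeriv, gammaDeriv_zero, integral_neg, ← M.integral_mom_pos_mul_mom_force 1] using h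

lemma Y_eq_zero_of_isWindow {J : Finset ℤ} {s k : ℤ} (hJ : M.IsWindow s F J) (hk : k ∉ J) :
    M.Y (-k) (-k + s) F = 0 := by
  have h := M.Y_add_shift_add F (-k) s k
  rwa [add_neg_cancel, shift_zero, hJ k hk] at h

lemma L_eq_sum {J : Finset ℤ} (hX : M.IsWindow 0 F J) (hY : M.IsWindow 1 F J) :
    M.L F = ∑ k ∈ J,
      ((M.γ / 2) • (M.X (-k) (M.X (-k) F) + M.Y (-k) (-k + 1) (M.Y (-k) (-k + 1) F)) +
        (M.X (-k) F - M.Y (-k) (-k + 1) F)) := by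
  have hX0 (k : ℤ) (hk : k ∉ J) : M.Y (-k) (-k) F = 0 := by
    have h := Y_eq_zero_of_isWindow hX hk
    rwa [add_zero] at h
  have hY0 (k : ℤ) (hk : k ∉ J) : M.Y (-k) (-k + 1) F = 0 := Y_eq_zero_of_isWindow hY hk
  have hzero (i j : ℤ) : M.Y i j 0 = 0 := M.Y_algebraMap 0 i j
  rw [Finset.sum_add_distrib, ← Finset.smul_sum, L]
  congr 1 <;> funext ω
  · rw [S, ← finsum_comp_equiv (Equiv.neg ℤ), finsum_eq_sum_of_support_subset (s := J)]
    · simp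
    · refine fun k hk => by_contra fun hkJ => hk ?_
      simp [hX0 k hkJ, hY0 k hkJ, X, hzero]
  · rw [A, ← finsum_comp_equiv (Equiv.neg ℤ), finsum_eq_sum_of_support_subset (s := J)]
    · simp
    · refine fun k hk => by_contra fun hkJ => hk ?_
      simp [hX0 k hkJ, hY0 k hkJ, X]

lemma shift_Y_neg (M : EnergyChain) (F : Config → ℝ) (k s : ℤ) :
    shift k (M.Y (-k) (-k + s) F) = M.Y 0 s (shift k F) := by
  rw [Y_shift, zero_sub, sub_eq_neg_add]

lemma L_mem_repSpace (hF : F ∈ M.testSpace) {J : Finset ℤ} (hX : M.IsWindow 0 F J)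
    (hY : M.IsWindow 1 F J) :
    (M.L F, (M.γ / 2) • M.Y 0 1 (partialGamma J F) - partialGamma J F,
      (M.γ / 2) • M.X 0 (partialGamma J F) + partialGamma J F) ∈ M.repSpace := by
  have hF' := mem_tame_of_mem_testSpace hF
  have hshiftX (k : ℤ) : shift k (M.X (-k) F) = M.Y 0 0 (shift k F) := by
    have h := M.shift_Y_neg F k 0
    rwa [add_zero] at h
  have hterm (k : ℤ) :
      ((M.γ / 2) • (M.X (-k) (M.X (-k) F) + M.Y (-k) (-k + 1) (M.Y (-k) (-k + 1) F)) +
          (M.X (-k) F - M.Y (-k) (-k + 1) F),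
        (M.γ / 2) • M.Y 0 1 (shift k F) - shift k F,
        (M.γ / 2) • M.Y 0 0 (shift k F) + shift k F) ∈ M.repSpace := by
    have hS := add_mem (X_mem_repSpace (Y_mem_tame_of_mem_testSpace hF (-k) (-k)) (-k))
      (Y_mem_repSpace (Y_mem_tame_of_mem_testSpace hF (-k) (-k + 1)) (-k))
    have hA := sub_mem (X_mem_repSpace hF' (-k)) (Y_mem_repSpace hF' (-k))
    have h := add_mem (Submodule.smul_mem _ (M.γ / 2) hS) hA
    rw [neg_neg] at h
    simpa [shift_Y_neg, ← hshiftX, X, sub_eq_add_neg] using h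
  rw [L_eq_sum hX hY, X, M.Y_partialGamma hF'.1, M.Y_partialGamma hF'.1, Finset.smul_sum,
    Finset.smul_sum, partialGamma, ← Finset.sum_sub_distrib, ← Finset.sum_add_distrib,
    prod_mk_sum, prod_mk_sum]
  exact sum_mem fun k _ => hterm k

end EnergyChain

lemma abs_le_two_mul_of_abs_le_add_sq {E H : Type*} [AddCommGroup E] [Module ℝ E]
    [NormedAddCommGroup H] [NormedSpace ℝ H] {ξ : E →ₗ[ℝ] H} {B : E →ₗ[ℝ] E →ₗ[ℝ] ℝ} {C : ℝ}
    (hC : 0 ≤ C) (hB : ∀ x y, |B x y| ≤ C * (‖ξ x‖ ^ 2 + ‖ξ y‖ ^ 2)) (x y : E) :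
    |B x y| ≤ 2 * C * ‖ξ x‖ * ‖ξ y‖ := by
  have hquad (t : ℝ) : 0 ≤ C * ‖ξ x‖ ^ 2 * (t * t) + -B x y * t + C * ‖ξ y‖ ^ 2 := by
    have h := le_of_abs_le (hB (t • x) y)
    rw [map_smul, map_smul, norm_smul, mul_pow, Real.norm_eq_abs, sq_abs, LinearMap.smul_apply,
      smul_eq_mul] at h
    linarith
  have hdiscrim := discrim_le_zero hquad
  rw [discrim] at hdiscrim
  exact abs_le_of_sq_le_sq (by linarith) (by positivity)

lemma inner_toLp_toLp {Ω : Type*} [MeasurableSpace Ω] {μ : Measure Ω} {u v : Ω → ℝ}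
    (hu : MemLp u 2 μ) (hv : MemLp v 2 μ) :
    inner ℝ (hu.toLp u) (hv.toLp v) = ∫ ω, u ω * v ω ∂μ := by
  rw [L2.inner_def]
  refine integral_congr_ae ?_
  filter_upwards [hu.coeFn_toLp, hv.coeFn_toLp] with ω hω hω'
  rw [hω, hω', RCLike.inner_apply, conj_trivial, mul_comm]

namespace EnergyChain

/-! ### The Dirichlet form of the generator -/

variable {M : EnergyChain} {F g h : Config → ℝ}

variable (M)

/-- The pairs of square integrable functions, in which `(Y_{0,1} Φ, X_0 Φ)` takes its values. -/
abbrev PairSpace : Type := WithLp 2 (Lp ℝ 2 M.gibbs × Lp ℝ 2 M.gibbs)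

/-- The inclusion of the tame functions into `L²(ν_β)`. -/
def tameToLp : M.tame →ₗ[ℝ] Lp ℝ 2 M.gibbs where
  toFun Φ := (memLp_of_mem_tame Φ.2).toLp Φ
  map_add' _ _ := rfl
  map_smul' _ _ := rfl

/-- `Y_{i,j}` as a map from the tame functions to `L²(ν_β)`. -/
def tameY (i j : ℤ) : M.tame →ₗ[ℝ] Lp ℝ 2 M.gibbs where
  toFun Φ := (memLp_Y Φ.2 i j).toLp (M.Y i j Φ)
  map_add' Φ Ψ := by
    rw [← MemLp.toLp_add]
    exact MemLp.toLp_congr _ _ (.of_eq (M.Y_add Φ.2.1 Ψ.2.1 i j))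
  map_smul' c Φ := by
    rw [RingHom.id_apply, ← MemLp.toLp_const_smul]
    exact MemLp.toLp_congr _ _ (.of_eq (M.Y_smul Φ.2.1 c i j))

/-- `Φ ↦ (Y_{0,1} Φ, X_0 Φ)`. -/
def pairDeriv : M.tame →ₗ[ℝ] M.PairSpace :=
  (WithLp.linearEquiv 2 ℝ (Lp ℝ 2 M.gibbs × Lp ℝ 2 M.gibbs)).symm.toLinearMap ∘ₗ
    (M.tameY 0 1).prod (M.tameY 0 0)

/-- The bilinear form of `-(γ/2) (X_0² + Y_{0,1}²) + X_0 - Y_{0,1}`, up to transposition of the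
antisymmetric part. -/
def genForm : M.tame →ₗ[ℝ] M.tame →ₗ[ℝ] ℝ :=
  (M.γ / 2) • (innerₗ M.PairSpace).compl₁₂ M.pairDeriv M.pairDeriv +
    (innerₗ (Lp ℝ 2 M.gibbs)).compl₁₂ M.tameToLp (M.tameY 0 0 - M.tameY 0 1)

variable {M}

lemma inner_pairDeriv (Ψ Φ : M.tame) : inner ℝ (M.pairDeriv Ψ) (M.pairDeriv Φ) =
    (∫ ω, M.Y 0 1 Ψ ω * M.Y 0 1 Φ ω ∂M.gibbs) + ∫ ω, M.X 0 Ψ ω * M.X 0 Φ ω ∂M.gibbs := by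
  rw [WithLp.prod_inner_apply]
  exact congrArg₂ _ (inner_toLp_toLp (memLp_Y Ψ.2 0 1) (memLp_Y Φ.2 0 1))
    (inner_toLp_toLp (memLp_Y Ψ.2 0 0) (memLp_Y Φ.2 0 0))

lemma norm_pairDeriv_sq (Φ : M.tame) : ‖M.pairDeriv Φ‖ ^ 2 =
    (∫ ω, M.Y 0 1 Φ ω ^ 2 ∂M.gibbs) + ∫ ω, M.X 0 Φ ω ^ 2 ∂M.gibbs := by
  rw [← real_inner_self_eq_norm_sq, inner_pairDeriv]
  simp only [sq]

lemma genForm_apply (Ψ Φ : M.tame) : M.genForm Ψ Φ =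
    M.γ / 2 * inner ℝ (M.pairDeriv Ψ) (M.pairDeriv Φ) +
      ((∫ ω, (Ψ : Config → ℝ) ω * M.X 0 Φ ω ∂M.gibbs) -
        ∫ ω, (Ψ : Config → ℝ) ω * M.Y 0 1 Φ ω ∂M.gibbs) := by
  have hinner (i j : ℤ) : inner ℝ (M.tameToLp Ψ) (M.tameY i j Φ) =
      ∫ ω, (Ψ : Config → ℝ) ω * M.Y i j Φ ω ∂M.gibbs :=
    inner_toLp_toLp (memLp_of_mem_tame Ψ.2) (memLp_Y Φ.2 i j)
  simp only [genForm, LinearMap.add_apply, LinearMap.smul_apply, LinearMap.compl₁₂_apply,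
    innerₗ_apply_apply, LinearMap.sub_apply, inner_sub_right, hinner, smul_eq_mul, X]

lemma genForm_self (Φ : M.tame) : M.genForm Φ Φ = M.γ / 2 * ‖M.pairDeriv Φ‖ ^ 2 := by
  rw [genForm_apply, X, integral_self_mul_Y Φ.2, integral_self_mul_Y Φ.2, sub_self, add_zero,
    real_inner_self_eq_norm_sq]

lemma genForm_congr {Ψ Ψ' : M.tame} (hY : M.Y 0 1 Ψ = M.Y 0 1 Ψ') (hX : M.X 0 Ψ = M.X 0 Ψ') :
    M.genForm Ψ = M.genForm Ψ' := by
  refine LinearMap.ext fun Φ => ?_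
  have hX' := integral_mul_Y Ψ.2 Φ.2 0 0
  have hX'' := integral_mul_Y Ψ'.2 Φ.2 0 0
  simp only [X] at hX
  simp only [genForm_apply, inner_pairDeriv, X, hX', hX'', integral_mul_Y Ψ.2 Φ.2 0 1,
    integral_mul_Y Ψ'.2 Φ.2 0 1, hX, hY]

variable (M) in
lemma exists_abs_genForm_le : ∃ C, ∀ Ψ Φ : M.tame,
    |M.genForm Ψ Φ| ≤ C * ‖M.pairDeriv Ψ‖ * ‖M.pairDeriv Φ‖ := by
  obtain ⟨C, hC, hsector⟩ := M.exists_sector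
  have hγ := M.γ_pos
  refine ⟨_, abs_le_two_mul_of_abs_le_add_sq (C := M.γ / 4 + C) (by positivity) fun Ψ Φ => ?_⟩
  have hsymm : |M.γ / 2 * inner ℝ (M.pairDeriv Ψ) (M.pairDeriv Φ)| ≤
      M.γ / 4 * (‖M.pairDeriv Ψ‖ ^ 2 + ‖M.pairDeriv Φ‖ ^ 2) := by
    rw [abs_mul, abs_of_pos (by positivity)]
    nlinarith [abs_real_inner_le_norm (M.pairDeriv Ψ) (M.pairDeriv Φ),
      two_mul_le_add_sq ‖M.pairDeriv Ψ‖ ‖M.pairDeriv Φ‖]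
  have hantisymm : |(∫ ω, (Ψ : Config → ℝ) ω * M.X 0 Φ ω ∂M.gibbs) -
      ∫ ω, (Ψ : Config → ℝ) ω * M.Y 0 1 Φ ω ∂M.gibbs| ≤
      C * (‖M.pairDeriv Ψ‖ ^ 2 + ‖M.pairDeriv Φ‖ ^ 2) := by
    rw [norm_pairDeriv_sq, norm_pairDeriv_sq]
    refine ((abs_sub _ _).trans (add_le_add (hsector Ψ Ψ.2 Φ Φ.2 0 0)
      (hsector Ψ Ψ.2 Φ Φ.2 0 1))).trans_eq ?_
    simp only [X]
    ring
  rw [genForm_apply, add_mul]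
  exact (abs_add_le _ _).trans (add_le_add hsymm hantisymm)

end EnergyChain

namespace EnergyChain

/-! ### Potentials -/

variable {M : EnergyChain} {F g h : Config → ℝ} {a b : ℝ}

lemma trialDeriv_add (hF : IsSmoothLocal F) (hg : IsSmoothLocal g) (s : ℤ) :
    M.trialDeriv s (F + g) (a + b) = M.trialDeriv s F a + M.trialDeriv s g b := by
  rw [trialDeriv, trialDeriv, trialDeriv, M.gammaDeriv_add hF hg, add_mul, add_smul]
  abel

lemma trialDeriv_smul (hg : IsSmoothLocal g) (c : ℝ) (s : ℤ) :
    M.trialDeriv s (c • g) (c * a) = c • M.trialDeriv s g a := by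
  rw [trialDeriv, trialDeriv, M.gammaDeriv_smul hg, mul_assoc, mul_smul, smul_add]

/-- `Φ` is a tame function with the same derivatives along `Y_{0,1}` and `X_0` as the formal sum
`Γ_g + a ∑_k k ℰ_k`. -/
def IsPotential (M : EnergyChain) (g : Config → ℝ) (a : ℝ) (Φ : M.tame) : Prop :=
  M.Y 0 1 Φ = M.trialDeriv 1 g a ∧ M.X 0 Φ = M.trialDeriv 0 g a

lemma IsPotential.add {Φ Ψ : M.tame} (hΦ : M.IsPotential F a Φ) (hΨ : M.IsPotential g b Ψ)
    (hF : IsSmoothLocal F) (hg : IsSmoothLocal g) : M.IsPotential (F + g) (a + b) (Φ + Ψ) := by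
  rw [IsPotential, trialDeriv_add hF hg, trialDeriv_add hF hg, ← hΦ.1, ← hΦ.2, ← hΨ.1, ← hΨ.2]
  exact ⟨M.Y_add Φ.2.1 Ψ.2.1 0 1, M.Y_add Φ.2.1 Ψ.2.1 0 0⟩

lemma IsPotential.smul {Φ : M.tame} (hΦ : M.IsPotential g a Φ) (hg : IsSmoothLocal g) (c : ℝ) :
    M.IsPotential (c • g) (c * a) (c • Φ) := by
  rw [IsPotential, trialDeriv_smul hg, trialDeriv_smul hg, ← hΦ.1, ← hΦ.2]
  exact ⟨M.Y_smul Φ.2.1 c 0 1, M.Y_smul Φ.2.1 c 0 0⟩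

variable (M) in
lemma isPotential_energy : M.IsPotential 0 1 ⟨M.energy 1, M.energy_mem_tame 1⟩ := by
  simp [IsPotential, trialDeriv, gammaDeriv_zero, Y_energy_one, X_energy_one]

lemma isPotential_partialGamma (hg : g ∈ M.tame) {J : Finset ℤ} (hX : M.IsWindow 0 g J)
    (hY : M.IsWindow 1 g J) :
    M.IsPotential g 0 ⟨partialGamma J g, partialGamma_mem_tame hg J⟩ := by
  simp [IsPotential, trialDeriv, X, gammaDeriv_eq_Y_partialGamma hg.1 hX,
    gammaDeriv_eq_Y_partialGamma hg.1 hY]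

lemma exists_common_isWindow (hg : IsSmoothLocal g) :
    ∃ J, M.IsWindow 0 g J ∧ M.IsWindow 1 g J := by
  classical
  obtain ⟨J, hJ⟩ := M.exists_isWindow hg 0
  obtain ⟨J', hJ'⟩ := M.exists_isWindow hg 1
  exact ⟨J ∪ J', hJ.mono Finset.subset_union_left, hJ'.mono Finset.subset_union_right⟩

lemma exists_isPotential (hg : g ∈ M.tame) (a : ℝ) : ∃ Φ, M.IsPotential g a Φ := by
  obtain ⟨J, hX, hY⟩ := exists_common_isWindow hg.1
  have h := (isPotential_partialGamma hg hX hY).add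
    ((isPotential_energy M).smul (zero_mem M.tame).1 a) hg.1
    (smoothLocal.smul_mem (zero_mem M.tame).1 a)
  exact ⟨_, by simpa using h⟩

variable (M) in
/-- The tame functions that are potentials `Γ_g + a ∑_k k ℰ_k` of some trial pair `(g, a)`. -/
def potentials : Submodule ℝ M.tame where
  carrier := {Φ | ∃ g ∈ M.testSpace, ∃ a, M.IsPotential g a Φ}
  zero_mem' := ⟨0, zero_mem _, 0, by
    simpa using (isPotential_energy M).smul (zero_mem M.tame).1 0⟩
  add_mem' := by
    rintro Φ Ψ ⟨F, hF, a, hΦ⟩ ⟨g, hg, b, hΨ⟩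
    exact ⟨F + g, add_mem hF hg, a + b,
      hΦ.add hΨ (mem_tame_of_mem_testSpace hF).1 (mem_tame_of_mem_testSpace hg).1⟩
  smul_mem' := by
    rintro c Φ ⟨g, hg, a, hΦ⟩
    exact ⟨c • g, Submodule.smul_mem _ c hg, c * a, hΦ.smul (mem_tame_of_mem_testSpace hg).1 c⟩

/-! ### The slope of a potential -/

variable (M) in
/-- The pair `(p_0 r_1, -p_0 r_0)`, whose inner product with `(Y_{0,1} Φ, X_0 Φ)` is the pairing of
a potential `Φ` with the gradient `p_1² - p_0²`. -/
def slopeVector : M.PairSpace :=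
  WithLp.toLp 2 (M.tameToLp ⟨mom 0 * pos 1, mul_mem (M.mom_mem_tame 0) (M.pos_mem_tame 1)⟩,
    -M.tameToLp ⟨mom 0 * pos 0, mul_mem (M.mom_mem_tame 0) (M.pos_mem_tame 0)⟩)

lemma inner_slopeVector_pairDeriv (Φ : M.tame) :
    inner ℝ M.slopeVector (M.pairDeriv Φ) =
      (∫ ω, (mom 0 * pos 1) ω * M.Y 0 1 Φ ω ∂M.gibbs) -
        ∫ ω, (mom 0 * pos 0) ω * M.X 0 Φ ω ∂M.gibbs := by
  rw [WithLp.prod_inner_apply, sub_eq_add_neg]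
  have hp (i : ℤ) := memLp_of_mem_tame (mul_mem (M.mom_mem_tame 0) (M.pos_mem_tame i))
  refine congrArg₂ _ (inner_toLp_toLp (hp 1) (memLp_Y Φ.2 0 1)) ?_
  exact (inner_neg_left _ _).trans (congrArg _ (inner_toLp_toLp (hp 0) (memLp_Y Φ.2 0 0)))

variable (M) in
lemma norm_slopeVector_sq :
    ‖M.slopeVector‖ ^ 2 = 2 * M.β⁻¹ * ∫ ω, (ω 0).2 ^ 2 ∂M.gibbs := by
  have hp (i : ℤ) := memLp_of_mem_tame (mul_mem (M.mom_mem_tame 0) (M.pos_mem_tame i))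
  have hnorm (i : ℤ) : ‖(hp i).toLp‖ ^ 2 = M.β⁻¹ * ∫ ω, (ω 0).2 ^ 2 ∂M.gibbs := by
    rw [← real_inner_self_eq_norm_sq, inner_toLp_toLp, ← M.integral_mom_mul_pos_sq i]
    simp only [sq]
  rw [WithLp.prod_norm_sq_eq_of_L2, mul_assoc, two_mul]
  exact congrArg₂ _ (hnorm 1) ((congrArg (· ^ 2) (norm_neg _)).trans (hnorm 0))

variable (M) in
/-- The functional that recovers the coefficient `a` from a potential `Γ_g + a ∑_k k ℰ_k`. -/
def slope : M.tame →ₗ[ℝ] ℝ := M.β ^ 2 • innerₗ M.PairSpace M.slopeVector ∘ₗ M.pairDeriv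

lemma abs_slope_le (Φ : M.tame) :
    |M.slope Φ| ≤ M.β ^ 2 * ‖M.slopeVector‖ * ‖M.pairDeriv Φ‖ := by
  have h := abs_real_inner_le_norm M.slopeVector (M.pairDeriv Φ)
  rw [slope, LinearMap.smul_apply, LinearMap.comp_apply, innerₗ_apply_apply, smul_eq_mul, abs_mul,
    abs_of_nonneg (sq_nonneg M.β), mul_assoc]
  gcongr

lemma IsPotential.slope_eq {Φ : M.tame} (hΦ : M.IsPotential g a Φ) (hg : g ∈ M.testSpace) :
    M.slope Φ = a := by
  have h := starForm_add_starStarForm M.gradient_mem_repSpace hg a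
  rw [starForm_gradient (mem_tame_of_mem_testSpace hg), starStarForm_gradient, zero_add, ← hΦ.1,
    ← hΦ.2] at h
  have hinner : inner ℝ M.slopeVector (M.pairDeriv Φ) = a * M.β⁻¹ ^ 2 := by
    rw [h, inner_slopeVector_pairDeriv]
    simp only [Pi.neg_apply, neg_mul, integral_neg, neg_neg]
  rw [slope, LinearMap.smul_apply, LinearMap.comp_apply, innerₗ_apply_apply, hinner, smul_eq_mul]
  have := M.β_pos.ne'
  field_simp

/-! ### The variational problem on potentials -/

lemma IsPotential.norm_pairDeriv_sq {Φ : M.tame} (hΦ : M.IsPotential g a Φ) :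
    ‖M.pairDeriv Φ‖ ^ 2 =
      (∫ ω, (a * ((ω 0).1 * deriv M.V (ω 1).2) + M.YGamma g ω) ^ 2 ∂M.gibbs) +
        ∫ ω, M.XGamma g ω ^ 2 ∂M.gibbs := by
  have hX : M.X 0 Φ = M.XGamma g := by
    rw [hΦ.2, trialDeriv, Int.cast_zero, mul_zero, zero_smul, add_zero]
    rfl
  have hY (ω : Config) :
      M.Y 0 1 Φ ω = a * ((ω 0).1 * deriv M.V (ω 1).2) + M.YGamma g ω := by
    rw [hΦ.1, add_comm, trialDeriv, Int.cast_one, mul_one]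
    rfl
  rw [EnergyChain.norm_pairDeriv_sq, hX]
  simp only [hY]

lemma normSq_eq_dualNormSq {ℓ : M.potentials →ₗ[ℝ] ℝ}
    (hℓ : ∀ (Φ : M.potentials) (g : M.testSpace) (a : ℝ), M.IsPotential g a Φ →
      ℓ Φ = M.starForm g h + a * M.starStarForm h) :
    M.normSq h =
      dualNormSq (E := M.potentials) (M.pairDeriv.domRestrict M.potentials) (M.γ / 2) ℓ := by
  have hterm (Φ : M.potentials) (g : M.testSpace) (a : ℝ) (hΦ : M.IsPotential g a Φ) :
      2 * M.starForm g h + 2 * a * M.starStarForm h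
        - M.γ / 2 * ∫ ω, (a * ((ω 0).1 * deriv M.V (ω 1).2) + M.YGamma g ω) ^ 2 ∂M.gibbs
        - M.γ / 2 * ∫ ω, M.XGamma g ω ^ 2 ∂M.gibbs =
      2 * ℓ Φ - M.γ / 2 * ‖M.pairDeriv.domRestrict M.potentials Φ‖ ^ 2 := by
    rw [hℓ Φ g a hΦ, LinearMap.domRestrict_apply, hΦ.norm_pairDeriv_sq]
    ring
  refine le_antisymm (iSup₂_le fun g a => ?_) (iSup_le fun Φ => ?_)
  · obtain ⟨Φ, hΦ⟩ := exists_isPotential (mem_tame_of_mem_testSpace g.2) a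
    rw [hterm ⟨Φ, g, g.2, a, hΦ⟩ g a hΦ]
    exact le_iSup_of_le _ le_rfl
  · obtain ⟨g, hg, a, hΦ⟩ := Φ.2
    rw [← hterm Φ ⟨g, hg⟩ a hΦ]
    exact le_iSup₂_of_le ⟨g, hg⟩ a le_rfl

end EnergyChain

namespace EnergyChain

/-! ### The generator form as a pairing -/

variable {M : EnergyChain} {F g h h' u u' v v' : Config → ℝ} {a κ : ℝ} {Φ Ψ : M.tame}

variable (M) in
/-- The pair `((γ/2) Y_{0,1} Ψ - Ψ, (γ/2) X_0 Ψ + Ψ)`. It represents, in the sense of `repSpace`,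
the current if `Ψ = ℰ_1`, and `L F` if `Ψ` is a large enough finite part of `Γ_F`. -/
def genFlux : M.tame →ₗ[ℝ] (Config → ℝ) × (Config → ℝ) where
  toFun Ψ := ((M.γ / 2) • M.Y 0 1 Ψ - (Ψ : Config → ℝ), (M.γ / 2) • M.X 0 Ψ + (Ψ : Config → ℝ))
  map_add' Ψ Φ := by
    rw [X, X, X, Subalgebra.coe_add, M.Y_add Ψ.2.1 Φ.2.1, M.Y_add Ψ.2.1 Φ.2.1]
    ext1 <;> simp only [smul_add, Prod.fst_add, Prod.snd_add] <;> abel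
  map_smul' c Ψ := by
    rw [X, X, Subalgebra.coe_smul, M.Y_smul Ψ.2.1, M.Y_smul Ψ.2.1]
    ext1 <;> simp only [smul_sub, smul_add, smul_comm c, RingHom.id_apply, Prod.smul_fst,
      Prod.smul_snd]

lemma starForm_add_starStarForm_add_smul (hx : (h, u, v) ∈ M.repSpace)
    (hx' : (h', u', v') ∈ M.repSpace) (hg : g ∈ M.testSpace) (c : ℝ) :
    M.starForm g (h + c • h') + a * M.starStarForm (h + c • h') =
      (M.starForm g h + a * M.starStarForm h) +
        c * (M.starForm g h' + a * M.starStarForm h') := by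
  have hsum : (h + c • h', u + c • u', v + c • v') ∈ M.repSpace :=
    add_mem hx (Submodule.smul_mem _ c hx')
  have hD (s : ℤ) := memLp_trialDeriv (mem_tame_of_mem_testSpace hg) s a
  rw [starForm_add_starStarForm hsum hg, starForm_add_starStarForm hx hg,
    starForm_add_starStarForm hx' hg, integral_add_mul hx.1.2.1 (hx'.1.2.1.const_smul c) (hD 1),
    integral_add_mul hx.1.2.2 (hx'.1.2.2.const_smul c) (hD 0), integral_smul_mul,
    integral_smul_mul]
  ring

lemma starForm_add_starStarForm_eq_neg_genForm (hx : (h, M.genFlux Ψ) ∈ M.repSpace)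
    (hg : g ∈ M.testSpace) (hΦ : M.IsPotential g a Φ) :
    M.starForm g h + a * M.starStarForm h = -M.genForm Ψ Φ := by
  have hΨ := memLp_of_mem_tame Ψ.2
  have hY (i j : ℤ) : MemLp ((M.γ / 2) • M.Y i j Ψ) 2 M.gibbs := (memLp_Y Ψ.2 i j).const_smul _
  rw [starForm_add_starStarForm hx hg, ← hΦ.1, ← hΦ.2, sub_eq_add_neg (_ • _),
    ← neg_one_smul ℝ (Ψ : Config → ℝ),
    integral_add_mul (hY 0 1) (hΨ.const_smul _) (memLp_Y Φ.2 0 1), X, X,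
    integral_add_mul (hY 0 0) hΨ (memLp_Y Φ.2 0 0), integral_smul_mul, integral_smul_mul,
    integral_smul_mul, genForm_apply, inner_pairDeriv, X, X]
  ring

lemma exists_isPotential_current_sub_L (hF : F ∈ M.testSpace) :
    ∃ Ψ, M.IsPotential (-F) 1 Ψ ∧ (M.current - M.L F, M.genFlux Ψ) ∈ M.repSpace := by
  have hF' := mem_tame_of_mem_testSpace hF
  obtain ⟨J, hX, hY⟩ := exists_common_isWindow hF'.1
  have hpot := (isPotential_energy M).add ((isPotential_partialGamma hF' hX hY).smul hF'.1 (-1))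
    (zero_mem M.tame).1 (smoothLocal.smul_mem hF'.1 (-1))
  rw [zero_add, mul_zero, add_zero, neg_one_smul, neg_one_smul, ← sub_eq_add_neg] at hpot
  refine ⟨_, hpot, ?_⟩
  rw [map_sub]
  exact sub_mem M.current_mem_repSpace (L_mem_repSpace hF hX hY)

variable (M) in
/-- `Φ ↦ (Y_{0,1} Φ, X_0 Φ)` on potentials, whose norm defines `ℋ₋₁` by duality. -/
def potDeriv : M.potentials →ₗ[ℝ] M.PairSpace := M.pairDeriv.domRestrict M.potentials

variable (M) in
/-- The form `genForm` of the generator on potentials. -/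
def potForm : M.potentials →ₗ[ℝ] M.potentials →ₗ[ℝ] ℝ :=
  M.genForm.domRestrict₁₂ M.potentials M.potentials

variable (M) in
/-- The coefficient `a` of a potential `Γ_g + a ∑_k k ℰ_k`. -/
def potSlope : M.potentials →ₗ[ℝ] ℝ := M.slope.domRestrict M.potentials

lemma normSq_current_add_gradient_sub_L (hF : F ∈ M.testSpace) {Ψ : M.potentials}
    (hΨ : M.IsPotential (-F) 1 Ψ) (κ : ℝ) :
    M.normSq (M.current + κ • gradient - M.L F) =
      dualNormSq (E := M.potentials) M.potDeriv (M.γ / 2)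
        ((κ * M.β⁻¹ ^ 2) • M.potSlope - M.potForm Ψ) := by
  obtain ⟨Ψ', hΨ', hrep⟩ := exists_isPotential_current_sub_L hF
  have hform : M.genForm Ψ = M.genForm Ψ' :=
    genForm_congr (hΨ.1.trans hΨ'.1.symm) (hΨ.2.trans hΨ'.2.symm)
  refine normSq_eq_dualNormSq fun Φ g a hΦ => ?_
  have hslope : M.potSlope Φ = a := hΦ.slope_eq g.2
  have hpot : M.potForm Ψ Φ = M.genForm Ψ' Φ := by rw [← hform]; rfl
  rw [add_sub_right_comm, starForm_add_starStarForm_add_smul hrep M.gradient_mem_repSpace g.2,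
    starForm_add_starStarForm_eq_neg_genForm hrep g.2 hΦ,
    starForm_gradient (mem_tame_of_mem_testSpace g.2), starStarForm_gradient, LinearMap.sub_apply,
    LinearMap.smul_apply, hslope, hpot, smul_eq_mul]
  ring

lemma isDiffusionConstant_iff : M.IsDiffusionConstant κ ↔
    IsEffectiveCoeff (E := M.potentials) M.potDeriv (M.γ / 2) M.potForm M.potSlope
      (κ * M.β⁻¹ ^ 2) := by
  constructor
  · rintro ⟨-, F, hF⟩
    have hex (n : ℕ) := exists_isPotential (neg_mem (mem_tame_of_mem_testSpace (F n).2)) 1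
    choose Ψ hΨ using hex
    have hneg (n : ℕ) := neg_mem (F n).2
    refine ⟨fun n => ⟨Ψ n, _, hneg n, 1, hΨ n⟩, fun n => (hΨ n).slope_eq (hneg n), ?_⟩
    exact hF.congr fun n => normSq_current_add_gradient_sub_L (F n).2 (hΨ n) κ
  · rintro ⟨Ψ, hslope, hlim⟩
    choose g hg a hΨ using fun n => (Ψ n).2
    obtain rfl : a = fun _ => 1 := funext fun n => ((hΨ n).slope_eq (hg n)).symm.trans (hslope n)
    refine ⟨M.current_add_smul_gradient_mem_fluctSpace κ, fun n => ⟨-g n, neg_mem (hg n)⟩, ?_⟩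
    refine hlim.congr fun n => (normSq_current_add_gradient_sub_L (neg_mem (hg n)) ?_ κ).symm
    rw [neg_neg]
    exact hΨ n

variable (M) in
lemma potSlope_ne_zero : M.potSlope ≠ 0 := fun h => by
  have hE : M.slope ⟨M.energy 1, M.energy_mem_tame 1⟩ = 1 :=
    (isPotential_energy M).slope_eq (zero_mem _)
  have h0 := LinearMap.congr_fun h ⟨_, 0, zero_mem _, 1, isPotential_energy M⟩
  exact one_ne_zero (hE.symm.trans h0)

theorem existsUnique_isDiffusionConstant (M : EnergyChain) : ∃! κ, M.IsDiffusionConstant κ := by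
  obtain ⟨C, hC⟩ := M.exists_abs_genForm_le
  have hβ : M.β⁻¹ ^ 2 ≠ 0 := pow_ne_zero 2 (inv_ne_zero M.β_pos.ne')
  simp only [isDiffusionConstant_iff]
  rw [← (mulRight_bijective₀ _ hβ).existsUnique_iff]
  exact existsUnique_isEffectiveCoeff (E := M.potentials) (half_pos M.γ_pos) ⟨C, fun Ψ Φ => hC Ψ Φ⟩
    (fun Φ => (genForm_self _).ge) (fun Φ => abs_slope_le _) M.potSlope_ne_zero

theorem le_of_isDiffusionConstant (hκ : M.IsDiffusionConstant κ) :
    M.γ / (4 * M.β * ∫ ω, (ω 0).2 ^ 2 ∂M.gibbs) ≤ κ := by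
  obtain ⟨C, hC⟩ := M.exists_abs_genForm_le
  have hμ := div_sq_le_of_isEffectiveCoeff (E := M.potentials) (half_pos M.γ_pos)
    ⟨C, fun Ψ Φ => hC Ψ Φ⟩
    (fun Φ => (genForm_self _).ge) (fun Φ => abs_slope_le _) M.potSlope_ne_zero
    (isDiffusionConstant_iff.1 hκ)
  have hβ := M.β_pos
  rw [mul_pow, norm_slopeVector_sq] at hμ
  set R := ∫ ω, (ω 0).2 ^ 2 ∂M.gibbs
  calc M.γ / (4 * M.β * R) = M.γ / 2 / ((M.β ^ 2) ^ 2 * (2 * M.β⁻¹ * R)) * M.β ^ 2 := by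
        field_simp
        norm_num
    _ ≤ κ * M.β⁻¹ ^ 2 * M.β ^ 2 := by gcongr
    _ = κ := by field_simp

end EnergyChain

end

theorem mainTheorem4 (M : EnergyChain) :
    (∃! κ : ℝ, M.IsDiffusionConstant κ) ∧
      ∀ κ : ℝ, M.IsDiffusionConstant κ →
        M.γ / (4 * M.β * ∫ ω, (ω 0).2 ^ 2 ∂M.gibbs) ≤ κ :=
  ⟨M.existsUnique_isDiffusionConstant, fun _ => EnergyChain.le_of_isDiffusionConstant⟩
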